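/- A \emph{discrete filtered set} (d.f.s.) is a family $\Omega=(\Omega_L)_{L\in\mathbb R_{\ge0}}$ of finite subsets of $\mathbb C$ such that $\Omega_{L_1}\subseteq\Omega_{L_2}$ whenever $L_1\le L_2$, and $\Omega_\delta=\emptyset$ for some $\delta>0$. The \emph{sum} $\Omega*\Omega'$ of two d.f.s. is the d.f.s. defined by \[ (\Omega*\Omega')_L=\{\omega_1+\omega_2 \mid \omega_1\in\Omega_{L_1},\ \omega_2\in\Omega'_{L_2},\ L_1,L_2\ge0,\ L_1+L_2=L\}\cup\Omega_L\cup\Omega'_L ; \] this law is commutative and associative. With $\Omega^{*n}=\Omega*\cdots*\Omega$ ($n$ times), $\Omega^{*\infty}$ is the d.f.s. defined by $(\Omega^{*\infty})_L=\bigcup_{n\ge1}(\Omega^{*n})_L$. For a d.f.s. $\Omega$, let $\mathcal M_\Omega$ be the complement in $\mathbb R_{\ge0}\times\mathbb C$ of the closure of $\{(\lambda,\omega)\in\mathbb R_{\ge0}\times\mathbb C\mid\omega\in\Omega_\lambda\}$. A Lipschitz path $\gamma:[0,t_*]\to\mathbb C$ ($t_*\ge0$) with $\gamma(0)=0$ is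 \emph{$\Omega$-allowed} if $(L(\gamma_{|t}),\gamma(t))\in\mathcal M_\Omega$ for all $t\in[0,t_*]$, where $L(\gamma_{|t})$ is the length of the restriction of $\gamma$ to $[0,t]$. A convergent power series $\hat\varphi\in\mathbb C\{\zeta\}$ is \emph{$\Omega$-continuable} if it can be analytically continued along every $\Omega$-allowed path. A formal series $\tilde\varphi=\sum_{j\ge0}\varphi_jz^j\in\mathbb C[[z]]$ is \emph{$\Omega$-resurgent} if its formal Borel transform $\hat\varphi(\zeta)=\sum_{j\ge1}\varphi_j\frac{\zeta^{j-1}}{(j-1)!}$ (the term $\varphi_0$ being disregarded) is a convergent power series which is $\Omega$-continuable. The set of $\Omega$-resurgent series is denoted by $\mathscr R_\Omega$. \textbf{Theorem.} Let $r\ge1$ be an integer and let $\Omega_1,\dots,\Omega_r$ be d.f.s. Then, for any convergent power series $F(w_1,\dots,w_r)=\sum_{k\in\mathbb N^r}c_k\,w_1^{k_1}\cdots w_r^{k_r}\in\mathbb C\{w_1,\dots,w_r\}$ and for any $\tilde\varphi_1,\dots,\tilde\varphi_r\in\mathbb C[[z]]$ without constant term, \[ \tilde\varphi_1\in\mathscr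 R_{\Omega_1},\ \dots,\ \tilde\varphi_r\in\mathscr R_{\Omega_r} \quad\Longrightarrow\quad F(\tilde\varphi_1,\dots,\tilde\varphi_r)=\sum_{k\in\mathbb N^r}c_k\,\tilde\varphi_1^{k_1}\cdots\tilde\varphi_r^{k_r}\in\mathscr R_{\Omega^*}, \] where $\Omega^*=(\Omega_1*\cdots*\Omega_r)^{*\infty}$. -/

import Mathlib

open scoped NNReal Topology

noncomputable section

namespace Resurgence

/-- A discrete filtered set: a nondecreasing family `(Ω_L)_{L ≥ 0}` of finite subsets of `ℂ`
such that `Ω_δ = ∅` for some `δ > 0`. -/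
@[ext]
structure DFS where
  carrier : ℝ≥0 → Set ℂ
  finite' : ∀ L, (carrier L).Finite
  mono' : ∀ L₁ L₂, L₁ ≤ L₂ → carrier L₁ ⊆ carrier L₂
  empty' : ∃ δ : ℝ≥0, 0 < δ ∧ carrier δ = ∅

namespace DFS

/-- The family `(Ω * Ω')_L`, for arbitrary families of subsets of `ℂ`. -/
def sumCarrier (A B : ℝ≥0 → Set ℂ) (L : ℝ≥0) : Set ℂ :=
  {ω | ∃ L₁ L₂ : ℝ≥0, L₁ + L₂ = L ∧ ∃ ω₁ ∈ A L₁, ∃ ω₂ ∈ B L₂, ω = ω₁ + ω₂} ∪ A L ∪ B L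

/-- The sum of two discrete filtered sets, written `Ω * Ω'`. -/
instance : Mul DFS where
  mul Ω Ω' :=
    { carrier := sumCarrier Ω.carrier Ω'.carrier
      finite' := by
        intro L
        refine (Set.Finite.union ?_ (Ω.finite' L)).union (Ω'.finite' L)
        refine (Set.Finite.image2 (fun x y => x + y) (Ω.finite' L) (Ω'.finite' L)).subset ?_
        rintro ω ⟨L₁, L₂, h, ω₁, h₁, ω₂, h₂, rfl⟩
        exact ⟨ω₁, Ω.mono' L₁ L (h ▸ le_self_add) h₁, ω₂, Ω'.mono' L₂ L (h ▸ le_add_self) h₂, rfl⟩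
      mono' := by
        rintro L L' hL ω ((⟨L₁, L₂, h, ω₁, h₁, ω₂, h₂, rfl⟩ | h) | h)
        · obtain ⟨d, rfl⟩ := exists_add_of_le hL
          refine Or.inl (Or.inl ⟨L₁, L₂ + d, by rw [← h, add_assoc], ω₁, h₁, ω₂, ?_, rfl⟩)
          exact Ω'.mono' L₂ _ le_self_add h₂
        · exact Or.inl (Or.inr (Ω.mono' L L' hL h))
        · exact Or.inr (Ω'.mono' L L' hL h)
      empty' := by
        obtain ⟨δ, hδ, e⟩ := Ω.empty'
        obtain ⟨δ', hδ', e'⟩ := Ω'.empty'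
        have key : ∀ x ≤ min δ δ', Ω.carrier x = ∅ ∧ Ω'.carrier x = ∅ := fun x hx =>
          ⟨Set.subset_empty_iff.1 (e ▸ Ω.mono' x δ (hx.trans (min_le_left _ _))),
            Set.subset_empty_iff.1 (e' ▸ Ω'.mono' x δ' (hx.trans (min_le_right _ _)))⟩
        refine ⟨min δ δ', lt_min hδ hδ', Set.subset_empty_iff.1 ?_⟩
        rintro ω ((⟨L₁, L₂, h, ω₁, h₁, -⟩ | h) | h)
        · rwa [(key L₁ (h ▸ le_self_add)).1] at h₁
        · rwa [(key _ le_rfl).1] at h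
        · rwa [(key _ le_rfl).2] at h }

/-- The trivial discrete filtered set, all of whose members are empty: the unit for `*`. -/
instance : One DFS where
  one :=
    { carrier := fun _ => ∅
      finite' := fun _ => Set.finite_empty
      mono' := fun _ _ _ => subset_rfl
      empty' := ⟨1, one_pos, rfl⟩ }

theorem mem_mul {Ω Ω' : DFS} {L : ℝ≥0} {ω : ℂ} :
    ω ∈ (Ω * Ω').carrier L ↔
      (∃ L₁ L₂ : ℝ≥0, L₁ + L₂ = L ∧ ∃ ω₁ ∈ Ω.carrier L₁, ∃ ω₂ ∈ Ω'.carrier L₂, ω = ω₁ + ω₂) ∨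
        ω ∈ Ω.carrier L ∨ ω ∈ Ω'.carrier L :=
  or_assoc

theorem notMem_one {L : ℝ≥0} {ω : ℂ} : ω ∉ (1 : DFS).carrier L := fun h => h

theorem mul_comm' (Ω Ω' : DFS) : Ω * Ω' = Ω' * Ω := by
  have key : ∀ (A B : DFS) (L : ℝ≥0) (ω : ℂ), ω ∈ (A * B).carrier L → ω ∈ (B * A).carrier L := by
    intro A B L ω h
    rw [mem_mul] at h ⊢
    rcases h with ⟨L₁, L₂, h, ω₁, h₁, ω₂, h₂, rfl⟩ | h | h
    · exact Or.inl ⟨L₂, L₁, by rw [← h, add_comm], ω₂, h₂, ω₁, h₁, add_comm _ _⟩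
    · exact Or.inr (Or.inr h)
    · exact Or.inr (Or.inl h)
  ext L ω
  exact ⟨key _ _ _ _, key _ _ _ _⟩

theorem one_mul' (Ω : DFS) : 1 * Ω = Ω := by
  ext L ω
  rw [mem_mul]
  simp [notMem_one]

theorem mul_assoc_aux {A B C : DFS} {L : ℝ≥0} {ω : ℂ} (h : ω ∈ (A * B * C).carrier L) :
    ω ∈ (A * (B * C)).carrier L := by
  simp only [mem_mul] at h ⊢
  rcases h with ⟨L₁, L₂, rfl, x, hx, c, hc, rfl⟩ | h | h
  · rcases hx with ⟨M₁, M₂, rfl, a, ha, b, hb, rfl⟩ | hx | hx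
    · exact Or.inl ⟨M₁, M₂ + L₂, (add_assoc _ _ _).symm, a, ha, b + c,
        Or.inl ⟨M₂, L₂, rfl, b, hb, c, hc, rfl⟩, add_assoc _ _ _⟩
    · exact Or.inl ⟨L₁, L₂, rfl, x, hx, c, Or.inr (Or.inr hc), rfl⟩
    · exact Or.inr (Or.inr (Or.inl ⟨L₁, L₂, rfl, x, hx, c, hc, rfl⟩))
  · rcases h with ⟨M₁, M₂, rfl, a, ha, b, hb, rfl⟩ | h | h
    · exact Or.inl ⟨M₁, M₂, rfl, a, ha, b, Or.inr (Or.inl hb), rfl⟩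
    · exact Or.inr (Or.inl h)
    · exact Or.inr (Or.inr (Or.inr (Or.inl h)))
  · exact Or.inr (Or.inr (Or.inr (Or.inr h)))

/-- The sum of discrete filtered sets is commutative and associative, with the trivial one as
unit; `Ω ^ n` is the `n`-fold sum `Ω * ⋯ * Ω`. -/
instance : CommMonoid DFS where
  mul_assoc A B C := by
    ext L ω
    refine ⟨mul_assoc_aux, fun h => ?_⟩
    rw [mul_comm' A, mul_comm' B] at h
    rw [mul_comm' (A * B), mul_comm' A]
    exact mul_assoc_aux h
  mul_comm := mul_comm'
  one_mul := one_mul'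
  mul_one Ω := by rw [mul_comm', one_mul']

open scoped Pointwise in
theorem pow_subset (Ω : DFS) {δ : ℝ≥0} (hδ : Ω.carrier δ = ∅) (n : ℕ) (L : ℝ≥0) (ω : ℂ)
    (h : ω ∈ (Ω ^ n).carrier L) : ∃ k : ℕ, 1 ≤ k ∧ k * δ ≤ L ∧ ω ∈ k • Ω.carrier L := by
  have hlt : ∀ (M : ℝ≥0) (x : ℂ), x ∈ Ω.carrier M → δ ≤ M := by
    intro M x hx
    by_contra hM
    have := Ω.mono' M δ (not_le.1 hM).le hx
    rwa [hδ] at this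
  induction n generalizing L ω with
  | zero => exact absurd h (by rw [pow_zero]; exact notMem_one)
  | succ n ih =>
    rw [pow_succ, mem_mul] at h
    rcases h with ⟨L₁, L₂, rfl, x, hx, y, hy, rfl⟩ | h | h
    · obtain ⟨k, hk, hkL, hxk⟩ := ih L₁ x hx
      refine ⟨k + 1, by omega, ?_, ?_⟩
      · push_cast
        rw [add_mul, one_mul]
        exact add_le_add hkL (hlt _ _ hy)
      · rw [succ_nsmul]
        refine Set.add_mem_add ?_ (Ω.mono' _ _ le_add_self hy)
        exact Set.nsmul_subset_nsmul_left (Ω.mono' _ _ le_self_add) hxk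
    · exact ih L ω h
    · exact ⟨1, le_rfl, by simpa using hlt _ _ h, by simpa using h⟩

open scoped Pointwise in
/-- The inductive limit `Ω^{*∞}` of the increasing sequence `Ω^{*n}`, `n ≥ 1`:
`(Ω^{*∞})_L = ⋃_{n ≥ 1} (Ω^{*n})_L`. -/
def iterSum (Ω : DFS) : DFS where
  carrier L := ⋃ n : ℕ, (Ω ^ (n + 1)).carrier L
  finite' := by
    intro L
    obtain ⟨δ, hδ, e⟩ := Ω.empty'
    have hf : ∀ k : ℕ, (k • Ω.carrier L).Finite := by
      intro k
      induction k with
      | zero => rw [zero_nsmul]; exact Set.finite_zero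
      | succ k ih => rw [succ_nsmul]; exact ih.add (Ω.finite' L)
    refine ((Set.finite_Iic ⌊L / δ⌋₊).biUnion (fun k _ => hf k)).subset ?_
    intro ω h
    obtain ⟨n, h⟩ := Set.mem_iUnion.1 h
    obtain ⟨k, -, hk, hω⟩ := pow_subset Ω e _ L ω h
    exact Set.mem_biUnion (Set.mem_Iic.2 (Nat.le_floor ((le_div_iff₀ hδ).2 hk))) hω
  mono' L₁ L₂ h := Set.iUnion_mono fun n => (Ω ^ (n + 1)).mono' L₁ L₂ h
  empty' := by
    obtain ⟨δ, hδ, e⟩ := Ω.empty'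
    refine ⟨δ, hδ, Set.subset_empty_iff.1 ?_⟩
    intro ω h
    obtain ⟨n, h⟩ := Set.mem_iUnion.1 h
    obtain ⟨k, hk, -, hω⟩ := pow_subset Ω e _ δ ω h
    obtain ⟨m, rfl⟩ := Nat.exists_eq_add_of_le' hk
    rwa [e, succ_nsmul, Set.add_empty] at hω

/-- The set `S_Ω` of all `(λ, ω)` with `ω ∈ Ω_λ`. -/
def graph (Ω : DFS) : Set (ℝ≥0 × ℂ) := {p | p.2 ∈ Ω.carrier p.1}

/-- The allowed open set `M_Ω`: the complement of the closure of `S_Ω` in `ℝ≥0 × ℂ`. -/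
def allowed (Ω : DFS) : Set (ℝ≥0 × ℂ) := (closure Ω.graph)ᶜ

end DFS

/-- The set `Π` of Lipschitz paths `γ : [0, t_*] → ℂ` with `γ(0) = 0` and `t_* ≥ 0`.
The values of `toFun` outside `[0, t_*]` are irrelevant. -/
structure LipPath where
  toFun : ℝ → ℂ
  tEnd : ℝ
  tEnd_nonneg : 0 ≤ tEnd
  lipschitz : ∃ K : ℝ≥0, LipschitzOnWith K toFun (Set.Icc 0 tEnd)
  map_zero : toFun 0 = 0

/-- The length `L(γ_{|t})` of the restriction of `γ` to `[0, t]`; this total variation is finite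
for `0 ≤ t ≤ t_*`, since `γ` is Lipschitz. -/
def LipPath.lengthUpTo (γ : LipPath) (t : ℝ) : ℝ≥0 :=
  (eVariationOn γ.toFun (Set.Icc 0 t)).toNNReal

/-- `Ω`-allowed paths. -/
def LipPath.IsAllowed (γ : LipPath) (Ω : DFS) : Prop :=
  ∀ t ∈ Set.Icc 0 γ.tEnd, (γ.lengthUpTo t, γ.toFun t) ∈ Ω.allowed

/-- The germ of `f` at `0` can be analytically continued along `γ`: there are holomorphic germs
`g t` at `γ t`, starting with the germ of `f`, such that for `s` close to `t` the germ `g s` is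
the one induced at `γ s` by `g t`. -/
def ContinuableAlong (f : ℂ → ℂ) (γ : LipPath) : Prop :=
  ∃ g : ℝ → ℂ → ℂ,
    (∀ t ∈ Set.Icc 0 γ.tEnd, AnalyticAt ℂ (g t) (γ.toFun t)) ∧
    g 0 =ᶠ[𝓝 0] f ∧
    ∀ t ∈ Set.Icc 0 γ.tEnd, ∀ᶠ s in 𝓝[Set.Icc 0 γ.tEnd] t, g s =ᶠ[𝓝 (γ.toFun s)] g t

/-- The set of `Ω`-continuable functions: the power series with positive radius of convergence
whose sum near `0` can be analytically continued along every `Ω`-allowed path. -/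
def continuable (Ω : DFS) : Set (PowerSeries ℂ) :=
  {φ | ∃ f : ℂ → ℂ,
    HasFPowerSeriesAt f
      (FormalMultilinearSeries.ofScalars ℂ fun n => PowerSeries.coeff n φ) 0 ∧
    ∀ γ : LipPath, γ.IsAllowed Ω → ContinuableAlong f γ}

/-- The formal Borel transform `∑ φ_j z^j ↦ φ_0 δ + ∑_{j ≥ 1} φ_j ζ^{j-1} / (j-1)!`; an element
`c δ + ψ` of `ℂ δ ⊕ ℂ[[ζ]]` is represented by the pair `(c, ψ)`. -/
def borel (φ : PowerSeries ℂ) : ℂ × PowerSeries ℂ :=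
  (PowerSeries.constantCoeff φ,
    PowerSeries.mk fun n => PowerSeries.coeff (n + 1) φ / (n.factorial : ℂ))

/-- The set of `Ω`-resurgent series: the preimage by the Borel transform of the direct sum of
`ℂ δ` and of the `Ω`-continuable functions. -/
def resurgent (Ω : DFS) : Set (PowerSeries ℂ) :=
  borel ⁻¹' (Set.univ ×ˢ continuable Ω)

/-- `F` is a convergent power series in `r` variables: it converges absolutely on some polydisc
centred at the origin. -/
def IsConvergent {r : ℕ} (F : MvPowerSeries (Fin r) ℂ) : Prop :=
  ∃ ρ : ℝ, 0 < ρ ∧ Summable fun k : Fin r →₀ ℕ => ‖MvPowerSeries.coeff k F‖ * ρ ^ k.degree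

end Resurgence

end

/-! On the Borel side products become convolutions, so the Borel transform of `F(φ₁, …, φᵣ)` is an
infinite sum of iterated convolutions. Estimating these terms one by one is avoided by packing all
substitutions into a single linear equation. Let `b` be the bounded family of rescaled coefficients
of `F`. Dividing each nonconstant monomial by its variable of least index gives `F_b = b₀ + ∑ᵢ wᵢ
F_{Sᵢ b}` with bounded operators `Sᵢ` (`shift`). Hence, with the operator-valued germ `f = ∑ᵢ φ̂ᵢ
Sᵢ` (`genFun`) and the solution `χ` of the Volterra equation `χ = f + χ * f`, the Borel transform
sought is `ζ ↦ (χ(ζ) b)₀` (`iteratedDeriv_resolvent`). It remains to continue `χ`.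

In `χ(ζ) = f(ζ) + ∫₀^ζ χ(u) f(ζ - u) du` let `ζ` follow an allowed path `p` (each point carrying the
length travelled) and deform the contour. A contour point `q` requires `χ` along `q` and `f` along
`p - q`. The increment of `p` is shared between the two factors: `p - q` receives the fraction `1 -
θ` and `q` the fraction `θ`, where `θ` is a Lipschitz cutoff equal to `1` near the singular set `S`
of `f` and to `0` away from it. So `p - q` stops before it meets `S`. The point `q` moves only when
`p - q` is close to some `s ∈ S`; if `q` were then close to `t ∈ T`, `p` would be close to `s + t ∈
T`, which is excluded (`margin_flow`, `margin_sub_flow`). Here `S` is the graph of `Ω₁ * ⋯ * Ωᵣ` and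
`T` that of its iterated sum.

The use of `χ` along `q` is not circular. Since `S` has no point of length less than `δ`, `p - q`
spends length more than `δ/2` before `q` starts to move, so `q` is shorter than `p` by that amount.
Contour points created during the last `δ/2` of the path do not move at all, and there the equation
is a Volterra equation on a disc of fixed radius. `ChainCont.step` thus gains length `δ/2` at each
application.

All deformations are discrete: paths become fine chains of points, isotopies become grids, and
Cauchy's theorem is applied cell by cell (`Grid.cell`). Compactness and extension to discs translate
between chains and Lipschitz paths. -/

noncomputable section

namespace Resurgence

open Set Metric Filter
open scoped Interval NNReal Topology

/-! ### Integrals along segments and local convolution -/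

section LineIntegral

variable {A : Type*} [NormedRing A] [NormedAlgebra ℂ A]

/-- The integral of `Φ` along the segment from `a` to `b`. -/
def lineInt (Φ : ℂ → A) (a b : ℂ) : A :=
  ∫ s in (0 : ℝ)..1, (b - a) • Φ (a + s * (b - a))

theorem lineInt_self (Φ : ℂ → A) (a : ℂ) : lineInt Φ a a = 0 := by
  simp [lineInt]

theorem Convex.add_mul_sub_mem {U : Set ℂ} (hU : Convex ℝ U) {a b : ℂ} (ha : a ∈ U) (hb : b ∈ U)
    {s : ℝ} (hs : s ∈ Icc (0 : ℝ) 1) : a + s * (b - a) ∈ U := by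
  have := hU.add_smul_sub_mem ha hb hs
  simpa using this

theorem lineInt_congr {Φ Ψ : ℂ → A} {U : Set ℂ} (hU : Convex ℝ U) {a b : ℂ} (ha : a ∈ U)
    (hb : b ∈ U) (h : EqOn Φ Ψ U) : lineInt Φ a b = lineInt Ψ a b := by
  refine intervalIntegral.integral_congr fun s hs => ?_
  rw [uIcc_of_le zero_le_one] at hs
  rw [h (Convex.add_mul_sub_mem hU ha hb hs)]

theorem norm_lineInt_le {Φ : ℂ → A} {a b : ℂ} {M : ℝ}
    (h : ∀ s ∈ Icc (0 : ℝ) 1, ‖Φ (a + s * (b - a))‖ ≤ M) : ‖lineInt Φ a b‖ ≤ ‖b - a‖ * M := by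
  have := intervalIntegral.norm_integral_le_of_norm_le_const (a := (0 : ℝ)) (b := 1)
    (f := fun s : ℝ => (b - a) • Φ (a + s * (b - a))) (C := ‖b - a‖ * M) ?_
  · rw [sub_zero, abs_one, mul_one] at this
    exact this
  · intro s hs
    rw [uIoc_of_le zero_le_one] at hs
    rw [norm_smul]
    exact mul_le_mul_of_nonneg_left (h s ⟨hs.1.le, hs.2⟩) (norm_nonneg _)

theorem hasDerivAt_integral_unit {F F' : ℂ → ℝ → A} {U : Set ℂ} (hU : IsOpen U)
    (hF : ContinuousOn (fun p : ℂ × ℝ => F p.1 p.2) (U ×ˢ Icc 0 1))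
    (hF' : ContinuousOn (fun p : ℂ × ℝ => F' p.1 p.2) (U ×ˢ Icc 0 1))
    (hd : ∀ z ∈ U, ∀ s ∈ Icc (0 : ℝ) 1, HasDerivAt (fun z => F z s) (F' z s) z)
    {z : ℂ} (hz : z ∈ U) :
    HasDerivAt (fun z => ∫ s in (0 : ℝ)..1, F z s) (∫ s in (0 : ℝ)..1, F' z s) z := by
  have hsec : ∀ {G : ℂ → ℝ → A}, ContinuousOn (fun p : ℂ × ℝ => G p.1 p.2) (U ×ˢ Icc 0 1) →
      ∀ w ∈ U, ContinuousOn (G w) (Icc 0 1) := by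
    intro G hG w hw
    exact hG.comp (f := fun s : ℝ => (w, s)) (by fun_prop) fun s hs => ⟨hw, hs⟩
  have hmeas : ∀ {G : ℂ → ℝ → A}, ContinuousOn (fun p : ℂ × ℝ => G p.1 p.2) (U ×ˢ Icc 0 1) →
      ∀ w ∈ U, MeasureTheory.AEStronglyMeasurable (G w)
        (MeasureTheory.volume.restrict (Ι (0 : ℝ) 1)) := by
    intro G hG w hw
    rw [uIoc_of_le zero_le_one]
    exact ((hsec hG w hw).aestronglyMeasurable_of_isCompact isCompact_Icc
      measurableSet_Icc).mono_set Ioc_subset_Icc_self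
  obtain ⟨R, hR, hRU⟩ := Metric.isOpen_iff.1 hU z hz
  have hsub : closedBall z (R / 2) ⊆ U :=
    (closedBall_subset_ball (by linarith)).trans hRU
  obtain ⟨M, hM⟩ := ((isCompact_closedBall z (R / 2)).prod
    (isCompact_Icc (a := (0 : ℝ)) (b := 1))).exists_bound_of_continuousOn
      (hF'.mono (prod_mono hsub subset_rfl))
  refine (intervalIntegral.hasDerivAt_integral_of_dominated_loc_of_deriv_le (s := ball z (R / 2))
    (bound := fun _ => M) (ball_mem_nhds z (by linarith)) ?_ ?_ (hmeas hF' z hz) ?_ ?_ ?_).2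
  · filter_upwards [hU.mem_nhds hz] with w hw using hmeas hF w hw
  · exact (by simpa [uIcc_of_le] using hsec hF z hz :
      ContinuousOn (F z) (uIcc 0 1)).intervalIntegrable
  · refine .of_forall fun s hs w hw => ?_
    rw [uIoc_of_le zero_le_one] at hs
    exact hM (w, s) ⟨ball_subset_closedBall hw, hs.1.le, hs.2⟩
  · exact intervalIntegrable_const
  · refine .of_forall fun s hs w hw => ?_
    rw [uIoc_of_le zero_le_one] at hs
    exact hd w (hsub (ball_subset_closedBall hw)) s ⟨hs.1.le, hs.2⟩

/-- The convolution product of `X` (near `c`) and `V` (near `0`). -/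
def conv (c : ℂ) (X V : ℂ → A) (z : ℂ) : A := lineInt (fun u => X u * V (z - u)) c z

theorem conv_self (c : ℂ) (X V : ℂ → A) : conv c X V c = 0 := lineInt_self _ _

theorem sub_mem_ball_zero {c z : ℂ} {R : ℝ} (hz : z ∈ ball c R) {s : ℝ} (hs : s ∈ Icc (0 : ℝ) 1) :
    z - (c + s * (z - c)) ∈ ball (0 : ℂ) R := by
  rw [mem_ball_zero_iff]
  rw [mem_ball_iff_norm] at hz
  have : z - (c + s * (z - c)) = ((1 - s : ℝ) : ℂ) * (z - c) := by push_cast; ring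
  rw [this, norm_mul, Complex.norm_real, Real.norm_of_nonneg (by linarith [hs.2])]
  exact lt_of_le_of_lt (mul_le_of_le_one_left (norm_nonneg _) (by linarith [hs.1])) hz

variable [CompleteSpace A]

theorem exists_primitive_lineInt {Φ : ℂ → A} {c : ℂ} {R : ℝ} (h : DifferentiableOn ℂ Φ (ball c R)) :
    ∃ Q : ℂ → A, ∀ a ∈ ball c R, ∀ b ∈ ball c R, lineInt Φ a b = Q b - Q a := by
  obtain ⟨Q, hQ⟩ := h.isExactOn_ball
  refine ⟨Q, fun a ha b hb => ?_⟩
  have hmem : ∀ s ∈ Icc (0 : ℝ) 1, a + s * (b - a) ∈ ball c R := fun s hs =>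
    Convex.add_mul_sub_mem (convex_ball c R) ha hb hs
  have hd : ∀ s ∈ uIcc (0 : ℝ) 1, HasDerivAt (fun s : ℝ => Q (a + s * (b - a)))
      ((b - a) • Φ (a + s * (b - a))) s := by
    intro s hs
    rw [uIcc_of_le zero_le_one] at hs
    have h1 : HasDerivAt (fun s : ℝ => a + (s : ℂ) * (b - a)) (b - a) s := by
      simpa using ((Complex.ofRealCLM.hasDerivAt (x := s)).mul_const (b - a)).const_add a
    exact (hQ _ (hmem s hs)).scomp s h1
  have hc : ContinuousOn (fun s : ℝ => (b - a) • Φ (a + s * (b - a))) (uIcc 0 1) := by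
    rw [uIcc_of_le zero_le_one]
    refine ContinuousOn.const_smul ?_ _
    exact h.continuousOn.comp (by fun_prop) hmem
  rw [lineInt, intervalIntegral.integral_eq_sub_of_hasDerivAt hd hc.intervalIntegrable]
  simp

theorem differentiableOn_lineInt_param {X V : ℂ → A} {a b c : ℂ} {U : Set ℂ} {R : ℝ}
    (hU : IsOpen U) {D : Set ℂ} (hD : Convex ℝ D) (ha : a ∈ D) (hb : b ∈ D)
    (hX : ContinuousOn X D) (hV : DifferentiableOn ℂ V (ball c R))
    (h : ∀ z ∈ U, ∀ u ∈ D, z - u ∈ ball c R) :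
    DifferentiableOn ℂ (fun z => lineInt (fun u => X u * V (z - u)) a b) U := by
  have hmem : ∀ s ∈ Icc (0 : ℝ) 1, a + s * (b - a) ∈ D := fun s hs =>
    Convex.add_mul_sub_mem hD ha hb hs
  have hXc : ContinuousOn (fun p : ℂ × ℝ => X (a + p.2 * (b - a))) (U ×ˢ Icc 0 1) :=
    hX.comp (by fun_prop) fun p hp => hmem _ hp.2
  have hsub : ∀ p ∈ U ×ˢ Icc (0 : ℝ) 1, p.1 - (a + p.2 * (b - a)) ∈ ball c R := fun p hp =>
    h _ hp.1 _ (hmem _ hp.2)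
  intro z hz
  refine (hasDerivAt_integral_unit hU
    (F' := fun z s => (b - a) • (X (a + s * (b - a)) * deriv V (z - (a + s * (b - a)))))
    ?_ ?_ ?_ hz).differentiableAt.differentiableWithinAt
  · refine ContinuousOn.smul continuousOn_const (hXc.mul ?_)
    exact hV.continuousOn.comp (by fun_prop) hsub
  · refine ContinuousOn.smul continuousOn_const (hXc.mul ?_)
    exact (hV.deriv isOpen_ball).continuousOn.comp (by fun_prop) hsub
  · intro w hw s hs
    have h1 := (hV.differentiableAt (isOpen_ball.mem_nhds (hsub (w, s) ⟨hw, hs⟩))).hasDerivAt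
    have h2 : HasDerivAt (fun z : ℂ => z - (a + s * (b - a))) 1 w :=
      (hasDerivAt_id w).sub_const _
    have h3 := h1.scomp w h2
    simp only [one_smul] at h3
    exact (h3.const_mul _).const_smul (b - a)

/-- After the substitution `u = c + s (z - c)` one differentiates under the integral sign. The
result differs from the integrand of `conv c X (deriv V)` by the `s`-derivative of `s X V`, whose
integral is the boundary term. -/
theorem hasDerivAt_conv {c : ℂ} {X V : ℂ → A} {R : ℝ} (hX : DifferentiableOn ℂ X (ball c R))
    (hV : DifferentiableOn ℂ V (ball 0 R)) {z : ℂ} (hz : z ∈ ball c R) :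
    HasDerivAt (conv c X V) (X z * V 0 + conv c X (deriv V) z) z := by
  have hR : 0 < R := pos_of_mem_ball hz
  have hmem : ∀ p ∈ ball c R ×ˢ Icc (0 : ℝ) 1, c + p.2 * (p.1 - c) ∈ ball c R := fun p hp =>
    Convex.add_mul_sub_mem (convex_ball c R) (mem_ball_self hR) hp.1 hp.2
  have hsub : ∀ p ∈ ball c R ×ˢ Icc (0 : ℝ) 1, p.1 - (c + p.2 * (p.1 - c)) ∈ ball (0 : ℂ) R :=
    fun p hp => sub_mem_ball_zero hp.1 hp.2
  have hX' := hX.deriv isOpen_ball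
  have hV' := hV.deriv isOpen_ball
  have cX : ContinuousOn (fun p : ℂ × ℝ => X (c + p.2 * (p.1 - c))) (ball c R ×ˢ Icc 0 1) :=
    hX.continuousOn.comp (by fun_prop) hmem
  have cX' : ContinuousOn (fun p : ℂ × ℝ => deriv X (c + p.2 * (p.1 - c)))
      (ball c R ×ˢ Icc 0 1) := hX'.continuousOn.comp (by fun_prop) hmem
  have cV : ContinuousOn (fun p : ℂ × ℝ => V (p.1 - (c + p.2 * (p.1 - c))))
      (ball c R ×ˢ Icc 0 1) := hV.continuousOn.comp (by fun_prop) hsub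
  have cV' : ContinuousOn (fun p : ℂ × ℝ => deriv V (p.1 - (c + p.2 * (p.1 - c))))
      (ball c R ×ˢ Icc 0 1) := hV'.continuousOn.comp (by fun_prop) hsub
  have dX : ∀ w ∈ ball c R, ∀ s ∈ Icc (0 : ℝ) 1, HasDerivAt X (deriv X (c + s * (w - c)))
      (c + s * (w - c)) := fun w hw s hs =>
    (hX.differentiableAt (isOpen_ball.mem_nhds (hmem (w, s) ⟨hw, hs⟩))).hasDerivAt
  have dV : ∀ w ∈ ball c R, ∀ s ∈ Icc (0 : ℝ) 1, HasDerivAt V (deriv V (w - (c + s * (w - c))))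
      (w - (c + s * (w - c))) := fun w hw s hs =>
    (hV.differentiableAt (isOpen_ball.mem_nhds (hsub (w, s) ⟨hw, hs⟩))).hasDerivAt
  let F' : ℂ → ℝ → A := fun w s =>
    (X (c + s * (w - c)) * V (w - (c + s * (w - c)))) + (w - c) •
      ((s : ℂ) • deriv X (c + s * (w - c)) * V (w - (c + s * (w - c))) +
        X (c + s * (w - c)) * ((1 - s : ℂ) • deriv V (w - (c + s * (w - c)))))
  have hs_cont : Continuous (fun p : ℂ × ℝ => ((p.2 : ℝ) : ℂ)) := by fun_prop
  have cF' : ContinuousOn (fun p : ℂ × ℝ => F' p.1 p.2) (ball c R ×ˢ Icc 0 1) := by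
    refine (cX.mul cV).add (ContinuousOn.smul (by fun_prop) ?_)
    exact ((hs_cont.continuousOn.smul cX').mul cV).add
      (cX.mul ((continuousOn_const.sub hs_cont.continuousOn).smul cV'))
  have key := hasDerivAt_integral_unit isOpen_ball
    (F := fun w s => (w - c) • (X (c + s * (w - c)) * V (w - (c + s * (w - c))))) (F' := F')
    (ContinuousOn.smul (by fun_prop) (cX.mul cV)) cF' ?_ hz
  · refine HasDerivAt.congr_deriv (f := conv c X V) key ?_
    have cs : ∀ {G : ℂ → ℝ → A}, ContinuousOn (fun p : ℂ × ℝ => G p.1 p.2)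
        (ball c R ×ˢ Icc 0 1) → IntervalIntegrable (G z) MeasureTheory.volume 0 1 := by
      intro G hG
      refine ContinuousOn.intervalIntegrable ?_
      rw [uIcc_of_le zero_le_one]
      exact hG.comp (f := fun s : ℝ => (z, s)) (by fun_prop) fun s hs => ⟨hz, hs⟩
    have cW : ContinuousOn (fun p : ℂ × ℝ => (p.1 - c) •
        (X (c + p.2 * (p.1 - c)) * deriv V (p.1 - (c + p.2 * (p.1 - c)))))
        (ball c R ×ˢ Icc 0 1) := ContinuousOn.smul (by fun_prop) (cX.mul cV')
    rw [← sub_eq_iff_eq_add, conv, lineInt]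
    rw [← intervalIntegral.integral_sub (cs (G := F') cF') (cs (G := fun w s => (w - c) •
        (X (c + s * (w - c)) * deriv V (w - (c + s * (w - c))))) cW)]
    -- The total derivative: its primitive vanishes at `s = 0` and equals `X z * V 0` at `s = 1`.
    have hprim : ∀ s ∈ uIcc (0 : ℝ) 1, HasDerivAt
        (fun s : ℝ => (s : ℂ) • (X (c + s * (z - c)) * V (z - (c + s * (z - c)))))
        (F' z s - (z - c) • (X (c + s * (z - c)) * deriv V (z - (c + s * (z - c))))) s := by
      intro s hs
      rw [uIcc_of_le zero_le_one] at hs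
      have h0 : HasDerivAt (fun s : ℝ => (s : ℂ)) 1 s := Complex.ofRealCLM.hasDerivAt
      have h1 : HasDerivAt (fun s : ℝ => c + (s : ℂ) * (z - c)) (z - c) s := by
        simpa using (h0.mul_const (z - c)).const_add c
      have h2 : HasDerivAt (fun s : ℝ => z - (c + (s : ℂ) * (z - c))) (-(z - c)) s :=
        h1.const_sub z
      have h3 := (dX z hz s hs).scomp s h1
      have h4 := (dV z hz s hs).scomp s h2
      refine (h0.smul (h3.mul h4)).congr_deriv ?_
      simp only [F', Function.comp_apply, Pi.mul_apply, smul_mul_assoc, mul_smul_comm, one_smul]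
      module
    rw [intervalIntegral.integral_eq_sub_of_hasDerivAt hprim]
    · simp
    · exact (cs (G := F') cF').sub (cs (G := fun w s => (w - c) •
        (X (c + s * (w - c)) * deriv V (w - (c + s * (w - c))))) cW)
  · intro w hw s hs
    have h0 : HasDerivAt (fun w : ℂ => w - c) 1 w := (hasDerivAt_id w).sub_const c
    have h1 : HasDerivAt (fun w : ℂ => c + (s : ℂ) * (w - c)) (s : ℂ) w := by
      simpa using (h0.const_mul (s : ℂ)).const_add c
    have h2 : HasDerivAt (fun w : ℂ => w - (c + (s : ℂ) * (w - c))) (1 - s : ℂ) w :=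
      (hasDerivAt_id w).sub h1
    have h3 := (dX w hw s hs).scomp w h1
    have h4 := (dV w hw s hs).scomp w h2
    refine (h0.smul (h3.mul h4)).congr_deriv ?_
    simp only [F', Function.comp_apply, Pi.mul_apply, smul_mul_assoc, mul_smul_comm, one_smul]
    module

theorem differentiableOn_conv {c : ℂ} {X V : ℂ → A} {R : ℝ} (hX : DifferentiableOn ℂ X (ball c R))
    (hV : DifferentiableOn ℂ V (ball 0 R)) : DifferentiableOn ℂ (conv c X V) (ball c R) :=
  fun _ hz => (hasDerivAt_conv hX hV hz).differentiableAt.differentiableWithinAt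

end LineIntegral

/-! ### Volterra equations on small discs -/

section Volterra

variable {A : Type*} [NormedRing A] [NormedAlgebra ℂ A]

theorem norm_conv_le {c : ℂ} {X V : ℂ → A} {R M B : ℝ} {z : ℂ} (hz : z ∈ ball c R)
    (hX : ∀ u ∈ closedBall c ‖z - c‖, ‖X u‖ ≤ B) (hV : ∀ u ∈ ball (0 : ℂ) R, ‖V u‖ ≤ M) :
    ‖conv c X V z‖ ≤ ‖z - c‖ * (B * M) := by
  refine norm_lineInt_le fun s hs => ?_
  have hmem : c + s * (z - c) ∈ closedBall c ‖z - c‖ :=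
    Convex.add_mul_sub_mem (convex_closedBall c _) (mem_closedBall_self (norm_nonneg _))
      (by simp [dist_eq_norm]) hs
  have h1 := hX _ hmem
  have h2 := hV _ (sub_mem_ball_zero hz hs)
  exact (norm_mul_le _ _).trans
    (mul_le_mul h1 h2 (norm_nonneg _) ((norm_nonneg _).trans h1))

theorem continuousOn_conv_integrand {c : ℂ} {X V : ℂ → A} {R : ℝ} (hX : ContinuousOn X (ball c R))
    (hV : ContinuousOn V (ball 0 R)) {z : ℂ} (hz : z ∈ ball c R) :
    ContinuousOn (fun s : ℝ => (z - c) • (X (c + s * (z - c)) * V (z - (c + s * (z - c)))))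
      (Icc 0 1) := by
  have hR : 0 < R := pos_of_mem_ball hz
  refine ContinuousOn.smul continuousOn_const (ContinuousOn.mul ?_ ?_)
  · exact hX.comp (by fun_prop) fun s hs =>
      Convex.add_mul_sub_mem (convex_ball c R) (mem_ball_self hR) hz hs
  · exact hV.comp (by fun_prop) fun s hs => sub_mem_ball_zero hz hs

theorem conv_sub {c : ℂ} {X Y V : ℂ → A} {R : ℝ} (hX : ContinuousOn X (ball c R))
    (hY : ContinuousOn Y (ball c R)) (hV : ContinuousOn V (ball 0 R)) {z : ℂ}
    (hz : z ∈ ball c R) : conv c X V z - conv c Y V z = conv c (fun u => X u - Y u) V z := by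
  rw [conv, conv, conv, lineInt, lineInt, lineInt, ← intervalIntegral.integral_sub]
  · simp only [sub_mul, smul_sub]
  · exact (by simpa [uIcc_of_le] using continuousOn_conv_integrand hX hV hz :
      ContinuousOn _ (uIcc (0 : ℝ) 1)).intervalIntegrable
  · exact (by simpa [uIcc_of_le] using continuousOn_conv_integrand hY hV hz :
      ContinuousOn _ (uIcc (0 : ℝ) 1)).intervalIntegrable

/-- At a maximum point of `‖D‖` on the closed disc through `z`, the equation bounds the maximum by
half of itself. -/
theorem eq_zero_of_eq_conv {c : ℂ} {D V : ℂ → A} {R M : ℝ} (hD : ContinuousOn D (ball c R))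
    (hV : ∀ u ∈ ball (0 : ℂ) R, ‖V u‖ ≤ M) (hRM : R * M ≤ 1 / 2)
    (h : ∀ z ∈ ball c R, D z = conv c D V z) : ∀ z ∈ ball c R, D z = 0 := by
  intro z hz
  have hR : 0 < R := pos_of_mem_ball hz
  have hM : 0 ≤ M := (norm_nonneg _).trans (hV 0 (mem_ball_self hR))
  have hsub : closedBall c ‖z - c‖ ⊆ ball c R := by
    intro u hu
    rw [mem_ball_iff_norm] at hz ⊢
    rw [mem_closedBall_iff_norm] at hu
    exact hu.trans_lt hz
  obtain ⟨w, hw, hmax⟩ := (isCompact_closedBall c ‖z - c‖).exists_isMaxOn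
    ⟨c, mem_closedBall_self (norm_nonneg _)⟩ (hD.mono hsub).norm
  have hB : ∀ u ∈ closedBall c ‖z - c‖, ‖D u‖ ≤ ‖D w‖ := fun u hu => hmax hu
  have hw' : ‖w - c‖ ≤ ‖z - c‖ := mem_closedBall_iff_norm.1 hw
  have h1 : ‖D w‖ ≤ ‖w - c‖ * (‖D w‖ * M) := by
    conv_lhs => rw [h w (hsub hw)]
    exact norm_conv_le (hsub hw) (fun u hu => hB u (closedBall_subset_closedBall hw' hu)) hV
  have h2 : ‖w - c‖ * (‖D w‖ * M) ≤ 1 / 2 * ‖D w‖ := by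
    have : ‖w - c‖ * M ≤ 1 / 2 :=
      (mul_le_mul_of_nonneg_right (mem_ball_iff_norm.1 (hsub hw)).le hM).trans hRM
    calc ‖w - c‖ * (‖D w‖ * M) = ‖w - c‖ * M * ‖D w‖ := by ring
      _ ≤ _ := mul_le_mul_of_nonneg_right this (norm_nonneg _)
  have h3 : ‖D w‖ = 0 := le_antisymm (by linarith) (norm_nonneg _)
  have h4 := hB z (by simp [dist_eq_norm])
  rw [h3] at h4
  exact norm_le_zero_iff.1 h4

/-- Uniqueness of the solution of a Volterra equation. -/
theorem eqOn_of_volterra {c : ℂ} {X Y G V : ℂ → A} {R M : ℝ} (hX : ContinuousOn X (ball c R))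
    (hY : ContinuousOn Y (ball c R)) (hVc : ContinuousOn V (ball 0 R))
    (hV : ∀ u ∈ ball (0 : ℂ) R, ‖V u‖ ≤ M) (hRM : R * M ≤ 1 / 2)
    (eX : ∀ z ∈ ball c R, X z = G z + conv c X V z)
    (eY : ∀ z ∈ ball c R, Y z = G z + conv c Y V z) : EqOn X Y (ball c R) := by
  intro z hz
  refine sub_eq_zero.1 (eq_zero_of_eq_conv (D := fun u => X u - Y u) (hX.sub hY) hV hRM ?_ z hz)
  intro w hw
  rw [← conv_sub hX hY hVc hw, eX w hw, eY w hw]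
  simp only [add_sub_add_left_eq_sub]

variable [CompleteSpace A]

/-- Existence of a holomorphic solution of a Volterra equation on a small disc. -/
theorem exists_volterra {c : ℂ} {G V : ℂ → A} {R M : ℝ} (hG : DifferentiableOn ℂ G (ball c R))
    (hVd : DifferentiableOn ℂ V (ball 0 R)) (hV : ∀ u ∈ ball (0 : ℂ) R, ‖V u‖ ≤ M)
    (hRM : R * M ≤ 1 / 2) :
    ∃ Y : ℂ → A, DifferentiableOn ℂ Y (ball c R) ∧ ∀ z ∈ ball c R, Y z = G z + conv c Y V z := by
  rcases le_or_gt R 0 with hR | hR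
  · exact ⟨G, hG, fun z hz => by simp [ball_eq_empty.2 hR] at hz⟩
  have hM : 0 ≤ M := (norm_nonneg _).trans (hV 0 (mem_ball_self hR))
  -- The terms of the Neumann series; each convolution with `V` costs a factor `R * M ≤ 1 / 2`.
  let K : ℕ → ℂ → A := fun n => Nat.rec G (fun _ X => conv c X V) n
  have K0 : K 0 = G := rfl
  have Ks : ∀ n, K (n + 1) = conv c (K n) V := fun n => rfl
  have Kd : ∀ n, DifferentiableOn ℂ (K n) (ball c R) := by
    intro n
    induction n with
    | zero => exact hG
    | succ n ih => exact differentiableOn_conv ih hVd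
  have bound : ∀ ρ, 0 ≤ ρ → ρ < R → ∃ B, 0 ≤ B ∧ ∀ n, ∀ z ∈ closedBall c ρ,
      ‖K n z‖ ≤ B * (1 / 2) ^ n := by
    intro ρ hρ0 hρ
    obtain ⟨B, hB⟩ := (isCompact_closedBall c ρ).exists_bound_of_continuousOn
      (hG.continuousOn.mono (closedBall_subset_ball hρ))
    have hB0 : 0 ≤ B := (norm_nonneg _).trans (hB c (mem_closedBall_self hρ0))
    refine ⟨B, hB0, fun n => ?_⟩
    induction n with
    | zero => intro z hz; simpa [K0] using hB z hz
    | succ n ih =>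
      intro z hz
      have hz' : ‖z - c‖ ≤ ρ := mem_closedBall_iff_norm.1 hz
      rw [Ks]
      refine (norm_conv_le (closedBall_subset_ball hρ hz)
        (fun u hu => ih u (closedBall_subset_closedBall hz' hu)) hV).trans ?_
      have h1 : ‖z - c‖ * M ≤ 1 / 2 :=
        (mul_le_mul_of_nonneg_right (hz'.trans hρ.le) hM).trans hRM
      calc ‖z - c‖ * (B * (1 / 2) ^ n * M) = ‖z - c‖ * M * (B * (1 / 2) ^ n) := by ring
        _ ≤ 1 / 2 * (B * (1 / 2) ^ n) := mul_le_mul_of_nonneg_right h1 (by positivity)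
        _ = B * (1 / 2) ^ (n + 1) := by ring
  have hsum : ∀ B : ℝ, Summable fun n : ℕ => B * (1 / 2 : ℝ) ^ n := fun B =>
    (summable_geometric_of_lt_one (by norm_num) (by norm_num)).mul_left B
  refine ⟨fun z => ∑' n, K n z, ?_, ?_⟩
  · intro z hz
    obtain ⟨ρ, h1, h2⟩ := exists_between (mem_ball_iff_norm.1 hz)
    obtain ⟨B, -, hB⟩ := bound ρ ((norm_nonneg _).trans h1.le) h2
    have := Complex.differentiableOn_tsum_of_summable_norm (hsum B)
      (fun n => (Kd n).mono (ball_subset_ball h2.le)) isOpen_ball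
      (fun n w hw => hB n w (ball_subset_closedBall hw))
    exact (this.differentiableAt
      (isOpen_ball.mem_nhds (mem_ball_iff_norm.2 h1))).differentiableWithinAt
  · intro z hz
    obtain ⟨B, hB0, hB⟩ := bound ‖z - c‖ (norm_nonneg _) (mem_ball_iff_norm.1 hz)
    have hmem : ∀ s ∈ Icc (0 : ℝ) 1, c + s * (z - c) ∈ closedBall c ‖z - c‖ := fun s hs =>
      Convex.add_mul_sub_mem (convex_closedBall c _) (mem_closedBall_self (norm_nonneg _))
        (by simp [dist_eq_norm]) hs
    have hs : ∀ u ∈ closedBall c ‖z - c‖, Summable fun n => K n u := fun u hu =>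
      Summable.of_norm_bounded (hsum B) fun n => hB n u hu
    have hint : HasSum (fun n => conv c (K n) V z) (conv c (fun u => ∑' n, K n u) V z) := by
      refine intervalIntegral.hasSum_integral_of_dominated_convergence
        (bound := fun n _ => ‖z - c‖ * (B * M) * (1 / 2) ^ n) ?_ ?_ ?_ ?_ ?_
      · intro n
        rw [uIoc_of_le zero_le_one]
        exact ((continuousOn_conv_integrand (Kd n).continuousOn hVd.continuousOn
          hz).aestronglyMeasurable_of_isCompact isCompact_Icc
          measurableSet_Icc).mono_set Ioc_subset_Icc_self
      · intro n
        refine .of_forall fun s hs => ?_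
        rw [uIoc_of_le zero_le_one] at hs
        have hs' : s ∈ Icc (0 : ℝ) 1 := ⟨hs.1.le, hs.2⟩
        rw [norm_smul]
        have h1 := hB n _ (hmem s hs')
        have h2 := hV _ (sub_mem_ball_zero hz hs')
        calc _ ≤ ‖z - c‖ * (B * (1 / 2) ^ n * M) := by
              refine mul_le_mul_of_nonneg_left ((norm_mul_le _ _).trans ?_) (norm_nonneg _)
              exact mul_le_mul h1 h2 (norm_nonneg _) (by positivity)
          _ = _ := by ring
      · exact .of_forall fun s _ => hsum _
      · exact intervalIntegrable_const
      · refine .of_forall fun s hs' => ?_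
        rw [uIoc_of_le zero_le_one] at hs'
        exact ((hs _ (hmem s ⟨hs'.1.le, hs'.2⟩)).hasSum.mul_right _).const_smul _
    rw [← hint.tsum_eq]
    exact (hs z (by simp [dist_eq_norm])).tsum_eq_zero_add

end Volterra

/-! ### Identity theorem on convex sets -/

section IdentityTheorem

variable {E : Type*} [NormedAddCommGroup E] [NormedSpace ℂ E] [CompleteSpace E]

theorem eqOn_of_eventuallyEq {X Y : ℂ → E} {U : Set ℂ} (hU : IsOpen U) (hc : Convex ℝ U)
    (hX : DifferentiableOn ℂ X U) (hY : DifferentiableOn ℂ Y U) {z : ℂ} (hz : z ∈ U)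
    (h : X =ᶠ[𝓝 z] Y) : EqOn X Y U :=
  (hX.analyticOnNhd hU).eqOn_of_preconnected_of_eventuallyEq (hY.analyticOnNhd hU)
    hc.isPreconnected hz h

theorem eqOn_inter_ball {X Y : ℂ → E} {a b z : ℂ} {R R' : ℝ}
    (hX : DifferentiableOn ℂ X (ball a R)) (hY : DifferentiableOn ℂ Y (ball b R'))
    (ha : z ∈ ball a R) (hb : z ∈ ball b R') (h : X =ᶠ[𝓝 z] Y) :
    EqOn X Y (ball a R ∩ ball b R') :=
  eqOn_of_eventuallyEq (isOpen_ball.inter isOpen_ball) ((convex_ball a R).inter (convex_ball b R'))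
    (hX.mono inter_subset_left) (hY.mono inter_subset_right) ⟨ha, hb⟩ h

end IdentityTheorem

/-! ### Analytic continuation along chains of discs -/

section Chains

variable {E : Type*} [NormedAddCommGroup E] [NormedSpace ℂ E]

/-- The functions `X j`, holomorphic on the discs `ball (z j) κ`, continue the germ of `f` at `0`
along the chain of points `z`. -/
structure ContAlong (f : ℂ → E) (z : ℕ → ℂ) (κ : ℝ) (X : ℕ → ℂ → E) : Prop where
  diff : ∀ j, DifferentiableOn ℂ (X j) (ball (z j) κ)
  start : X 0 =ᶠ[𝓝 0] f
  step : ∀ j, X (j + 1) =ᶠ[𝓝 (z (j + 1))] X j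

theorem ContAlong.mono {f : ℂ → E} {z : ℕ → ℂ} {κ κ' : ℝ} {X : ℕ → ℂ → E}
    (h : ContAlong f z κ X) (hκ : κ' ≤ κ) : ContAlong f z κ' X :=
  ⟨fun j => (h.diff j).mono (ball_subset_ball hκ), h.start, h.step⟩

variable [CompleteSpace E]

theorem ContAlong.eqOn_succ {f : ℂ → E} {z : ℕ → ℂ} {κ : ℝ} {X : ℕ → ℂ → E}
    (h : ContAlong f z κ X) (j : ℕ) (hz : ‖z (j + 1) - z j‖ < κ) :
    EqOn (X (j + 1)) (X j) (ball (z (j + 1)) κ ∩ ball (z j) κ) :=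
  eqOn_inter_ball (h.diff _) (h.diff _) (mem_ball_self ((norm_nonneg _).trans_lt hz))
    (mem_ball_iff_norm.2 hz) (h.step j)

/-- Continuations along two neighbouring chains agree. -/
theorem ContAlong.eqOn_of_near {f : ℂ → E} {z z' : ℕ → ℂ} {κ : ℝ} {X X' : ℕ → ℂ → E}
    (h : ContAlong f z κ X) (h' : ContAlong f z' κ X') (h0 : z 0 = 0) (h0' : z' 0 = 0)
    (hκ : 0 < κ) (hs : ∀ j, ‖z (j + 1) - z j‖ < κ / 4) (hs' : ∀ j, ‖z' (j + 1) - z' j‖ < κ / 4)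
    (hn : ∀ j, ‖z j - z' j‖ < κ / 4) (j : ℕ) :
    EqOn (X j) (X' j) (ball (z j) κ ∩ ball (z' j) κ) := by
  induction j with
  | zero =>
    refine eqOn_inter_ball (h.diff 0) (h'.diff 0) (z := 0) ?_ ?_ (h.start.trans h'.start.symm)
    · rw [h0]; exact mem_ball_self hκ
    · rw [h0']; exact mem_ball_self hκ
  | succ j ih =>
    have m1 : z j ∈ ball (z (j + 1)) κ := by
      rw [mem_ball_iff_norm']; linarith [hs j]
    have m2 : z j ∈ ball (z' j) κ := by
      rw [mem_ball_iff_norm]; linarith [hn j]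
    have m3 : z j ∈ ball (z' (j + 1)) κ := by
      rw [mem_ball_iff_norm]
      have : z j - z' (j + 1) = (z j - z' j) - (z' (j + 1) - z' j) := by ring
      rw [this]
      linarith [norm_sub_le (z j - z' j) (z' (j + 1) - z' j), hn j, hs' j]
    have m0 : z j ∈ ball (z j) κ := mem_ball_self hκ
    refine eqOn_inter_ball (h.diff _) (h'.diff _) m1 m3 ?_
    have e1 := h.eqOn_succ j (by linarith [hs j])
    have e2 := h'.eqOn_succ j (by linarith [hs' j])
    filter_upwards [isOpen_ball.mem_nhds m0, isOpen_ball.mem_nhds m1, isOpen_ball.mem_nhds m2,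
      isOpen_ball.mem_nhds m3] with u u0 u1 u2 u3
    rw [e1 ⟨u1, u0⟩, ih ⟨u0, u2⟩, e2 ⟨u3, u2⟩]

/-- If the chain does not move before time `i`, then neither does the continuation. -/
theorem ContAlong.eqOn_of_stationary {f : ℂ → E} {z : ℕ → ℂ} {κ : ℝ} {X : ℕ → ℂ → E}
    (h : ContAlong f z κ X) (hκ : 0 < κ) (hf : DifferentiableOn ℂ f (ball 0 κ)) {i : ℕ}
    (hz : ∀ j ≤ i, z j = 0) : ∀ j ≤ i, EqOn (X j) f (ball 0 κ) := by
  intro j hj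
  have hX : X j =ᶠ[𝓝 0] f := by
    induction j with
    | zero => exact h.start
    | succ j ih =>
      have := h.step j
      rw [hz _ hj] at this
      exact this.trans (ih (by omega))
  have hd := h.diff j
  rw [hz j hj] at hd
  exact eqOn_of_eventuallyEq isOpen_ball (convex_ball _ _) hd hf (mem_ball_self hκ) hX

end Chains

/-! ### Discrete contour deformation -/

section Grid

variable {A : Type*} [NormedRing A] [NormedAlgebra ℂ A]

/-- A discrete deformation of contours: at time `j` the contour attached to the chain `z` runs
through `0 = q 0 j, q 1 j, …, q j j = z j`. -/
structure Grid (z : ℕ → ℂ) (q : ℕ → ℕ → ℂ) (η : ℝ) : Prop where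
  left : ∀ j, q 0 j = 0
  diag : ∀ i j, j ≤ i → q i j = z j
  -- Each contour point rests for at least one step after its creation, so the new arc at time `i +
  -- 1` is the segment from `z i` to `z (i + 1)`.
  stay : ∀ i, q i (i + 1) = z i
  time : ∀ i j, ‖q i (j + 1) - q i j‖ < η
  time' : ∀ i j, ‖(z (j + 1) - q i (j + 1)) - (z j - q i j)‖ < η
  index : ∀ i j, ‖q (i + 1) j - q i j‖ < η

theorem Grid.zero {z : ℕ → ℂ} {q : ℕ → ℕ → ℂ} {η : ℝ} (g : Grid z q η) : z 0 = 0 := by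
  rw [← g.left 0, g.diag 0 0 le_rfl]

theorem Grid.start {z : ℕ → ℂ} {q : ℕ → ℕ → ℂ} {η : ℝ} (g : Grid z q η) (i : ℕ) : q i 0 = 0 := by
  rw [g.diag i 0 (Nat.zero_le _), g.zero]

theorem Grid.base {z : ℕ → ℂ} {q : ℕ → ℕ → ℂ} {η : ℝ} (g : Grid z q η) (j : ℕ) :
    ‖z (j + 1) - z j‖ < η := by
  rw [← g.diag (j + 1) (j + 1) le_rfl, ← g.diag (j + 1) j (Nat.le_succ _)]
  exact g.time _ _

/-- The part of the convolution integral at time `n` that is carried by the contour up to `z n`. -/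
def gridSum (q : ℕ → ℕ → ℂ) (X V : ℕ → ℕ → ℂ → A) (n : ℕ) (ζ : ℂ) : A :=
  V 0 n ζ + ∑ i ∈ Finset.range n,
    lineInt (fun u => X i n u * V i n (ζ - u)) (q i n) (q (i + 1) n)

theorem conv_congr_eventually {c : ℂ} {X Y V : ℂ → A} (h : X =ᶠ[𝓝 c] Y) :
    conv c X V =ᶠ[𝓝 c] conv c Y V := by
  obtain ⟨r, hr, hb⟩ := Metric.eventually_nhds_iff_ball.1 h
  filter_upwards [ball_mem_nhds c hr] with z hz
  refine lineInt_congr (convex_ball c r) (mem_ball_self hr) hz fun u hu => ?_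
  simp only [hb u hu]

variable [CompleteSpace A]
  {f χ : ℂ → A} {z : ℕ → ℂ} {q : ℕ → ℕ → ℂ} {κ : ℝ} {X V : ℕ → ℕ → ℂ → A} {n : ℕ}

theorem Grid.differentiableOn_gridSum (g : Grid z q (κ / 16)) (hκ : 0 < κ)
    (hV : ∀ i, ContAlong f (fun j => z j - q i j) (2 * κ) (V i))
    (hX : ∀ i < n, ContAlong χ (q i) κ (X i)) :
    DifferentiableOn ℂ (gridSum q X V n) (ball (z n) κ) := by
  refine DifferentiableOn.add ?_ (DifferentiableOn.fun_sum fun i hi => ?_)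
  · have := (hV 0).diff n
    simp only [g.left, sub_zero] at this
    exact this.mono (ball_subset_ball (by linarith))
  · refine differentiableOn_lineInt_param isOpen_ball (convex_ball (q i n) (κ / 2))
      (mem_ball_self (by linarith)) ?_ ?_ ((hV i).diff n) ?_
    · rw [mem_ball_iff_norm]; linarith [g.index i n]
    · exact ((hX i (Finset.mem_range.1 hi)).diff n).continuousOn.mono
        (ball_subset_ball (by linarith))
    · intro w hw u hu
      rw [mem_ball_iff_norm] at hw hu ⊢
      have : w - u - (z n - q i n) = (w - z n) - (u - q i n) := by ring
      rw [this]
      linarith [norm_sub_le (w - z n) (u - q i n)]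

/-- Up to time `i` the argument `z j - q i j` of `f` is still `0`, so nothing has been continued
yet. -/
theorem Grid.V_eqOn (g : Grid z q (κ / 16)) (hκ : 0 < κ)
    (hf : DifferentiableOn ℂ f (ball 0 (2 * κ)))
    (hV : ∀ i, ContAlong f (fun j => z j - q i j) (2 * κ) (V i)) (i j : ℕ) (hj : j ≤ i) :
    EqOn (V i j) f (ball 0 (2 * κ)) :=
  (hV i).eqOn_of_stationary (by linarith) hf (i := i)
    (fun k hk => by simp [g.diag i k hk]) j hj

theorem Grid.X_near (g : Grid z q (κ / 16)) (hκ : 0 < κ) {i : ℕ}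
    {Y Y' : ℕ → ℂ → A} (hX : ContAlong χ (q i) κ Y) (hX' : ContAlong χ (q (i + 1)) κ Y') (j : ℕ) :
    EqOn (Y j) (Y' j) (ball (q i j) κ ∩ ball (q (i + 1) j) κ) := by
  refine hX.eqOn_of_near hX' (g.start _) (g.start _) hκ (fun j => ?_) (fun j => ?_) (fun j => ?_) j
  · linarith [g.time i j]
  · linarith [g.time (i + 1) j]
  · rw [norm_sub_rev]; linarith [g.index i j]

theorem Grid.V_near (g : Grid z q (κ / 16)) (hκ : 0 < κ)
    (hV : ∀ i, ContAlong f (fun j => z j - q i j) (2 * κ) (V i)) (i j : ℕ) :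
    EqOn (V i j) (V (i + 1) j)
      (ball (z j - q i j) (2 * κ) ∩ ball (z j - q (i + 1) j) (2 * κ)) := by
  refine (hV i).eqOn_of_near (hV (i + 1)) ?_ ?_ (by linarith) (fun j => ?_) (fun j => ?_)
    (fun j => ?_) j
  · simp [g.start, g.zero]
  · simp [g.start, g.zero]
  · linarith [g.time' i j]
  · linarith [g.time' (i + 1) j]
  · have : z j - q i j - (z j - q (i + 1) j) = q (i + 1) j - q i j := by ring
    rw [this]; linarith [g.index i j]

/-- Deforming the contour from time `n` to time `n + 1` changes the contribution of each arc by
the integrals along the two trajectories bounding the corresponding cell. -/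
theorem Grid.cell (g : Grid z q (κ / 16)) (hκ : 0 < κ)
    (hV : ∀ i, ContAlong f (fun j => z j - q i j) (2 * κ) (V i)) {i : ℕ}
    (hX : ContAlong χ (q i) κ (X i)) (hX' : ContAlong χ (q (i + 1)) κ (X (i + 1)))
    {ζ : ℂ} (hζ : ζ ∈ ball (z (n + 1)) (κ / 4)) :
    lineInt (fun u => X i (n + 1) u * V i (n + 1) (ζ - u)) (q i (n + 1)) (q (i + 1) (n + 1)) -
      lineInt (fun u => X i n u * V i n (ζ - u)) (q i n) (q (i + 1) n) =
    lineInt (fun u => X (i + 1) n u * V (i + 1) n (ζ - u)) (q (i + 1) n) (q (i + 1) (n + 1)) -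
      lineInt (fun u => X i n u * V i n (ζ - u)) (q i n) (q i (n + 1)) := by
  have hζ1 := mem_ball_iff_norm.1 hζ
  have hζ0 : ‖ζ - z n‖ < κ / 4 + κ / 16 := by
    have : ζ - z n = (ζ - z (n + 1)) + (z (n + 1) - z n) := by ring
    rw [this]
    linarith [norm_add_le (ζ - z (n + 1)) (z (n + 1) - z n), g.base n]
  have t0 := g.time i n
  have t1 := g.time (i + 1) n
  have s0 := g.index i n
  have s1 := g.index i (n + 1)
  have tri : ∀ {a b c : ℂ} {r r' : ℝ}, ‖a - b‖ < r → ‖b - c‖ < r' → ‖a - c‖ < r + r' := by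
    intro a b c r r' h h'
    have : a - c = (a - b) + (b - c) := by ring
    rw [this]
    linarith [norm_add_le (a - b) (b - c)]
  set D := ball (q i n) (κ / 4) with hD
  have d0 : q i n ∈ D := mem_ball_self (by linarith)
  have d1 : q i (n + 1) ∈ D := mem_ball_iff_norm.2 (by linarith)
  have d2 : q (i + 1) n ∈ D := mem_ball_iff_norm.2 (by linarith)
  have d3 : q (i + 1) (n + 1) ∈ D := mem_ball_iff_norm.2 (by linarith [tri s1 t0])
  -- A single convex disc `D` contains the four corners of the cell and lies in all the domains
  -- involved. There the germs at the corners coincide, so one primitive computes all four edges.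
  have arg : ∀ u ∈ D, ∀ k l : ℕ, ‖q k l - q i n‖ < κ / 4 → ‖ζ - z l‖ < κ / 2 →
      u ∈ ball (q k l) κ ∧ ζ - u ∈ ball (z l - q k l) (2 * κ) := by
    intro u hu k l h1 h2
    have hu' := mem_ball_iff_norm.1 hu
    rw [norm_sub_rev] at h1
    have h3 := tri hu' h1
    refine ⟨mem_ball_iff_norm.2 (by linarith), mem_ball_iff_norm.2 ?_⟩
    have : ζ - u - (z l - q k l) = (ζ - z l) - (u - q k l) := by ring
    rw [this]
    linarith [norm_sub_le (ζ - z l) (u - q k l)]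
  have a0 : ∀ u ∈ D, _ := fun u hu => arg u hu i n (by simpa using by linarith) (by linarith)
  have a1 : ∀ u ∈ D, _ := fun u hu => arg u hu i (n + 1) (by linarith) (by linarith)
  have a2 : ∀ u ∈ D, _ := fun u hu => arg u hu (i + 1) n (by linarith) (by linarith)
  have hΦ : DifferentiableOn ℂ (fun u => X i n u * V i n (ζ - u)) D := by
    refine DifferentiableOn.mul ((hX.diff n).mono fun u hu => (a0 u hu).1) ?_
    exact ((hV i).diff n).comp (by fun_prop) fun u hu => (a0 u hu).2
  obtain ⟨Q, hQ⟩ := exists_primitive_lineInt hΦ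
  have e1 : lineInt (fun u => X i (n + 1) u * V i (n + 1) (ζ - u)) (q i (n + 1))
      (q (i + 1) (n + 1)) = Q (q (i + 1) (n + 1)) - Q (q i (n + 1)) := by
    rw [← hQ _ d1 _ d3]
    refine lineInt_congr (convex_ball _ _) d1 d3 fun u hu => ?_
    have x1 := hX.eqOn_succ n (by linarith) ⟨(a1 u hu).1, (a0 u hu).1⟩
    have x2 := (hV i).eqOn_succ n (by linarith [g.time' i n]) ⟨(a1 u hu).2, (a0 u hu).2⟩
    simp only [x1, x2]
  have e2 : lineInt (fun u => X (i + 1) n u * V (i + 1) n (ζ - u)) (q (i + 1) n)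
      (q (i + 1) (n + 1)) = Q (q (i + 1) (n + 1)) - Q (q (i + 1) n) := by
    rw [← hQ _ d2 _ d3]
    refine lineInt_congr (convex_ball _ _) d2 d3 fun u hu => ?_
    have x1 := g.X_near hκ hX hX' n ⟨(a0 u hu).1, (a2 u hu).1⟩
    have x2 := g.V_near hκ hV i n ⟨(a0 u hu).2, (a2 u hu).2⟩
    simp only [x1, x2]
  rw [e1, e2, hQ _ d0 _ d2, hQ _ d0 _ d1]
  abel

/-- The convolution equation propagates from time `n` to time `n + 1`. -/
theorem Grid.transfer (g : Grid z q (κ / 16)) (hκ : 0 < κ)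
    (hf : DifferentiableOn ℂ f (ball 0 (2 * κ)))
    (hV : ∀ i, ContAlong f (fun j => z j - q i j) (2 * κ) (V i))
    (hX : ∀ i ≤ n, ContAlong χ (q i) κ (X i))
    (h : ∀ᶠ ζ in 𝓝 (z n), X n n ζ = gridSum q X V n ζ + conv (z n) (X n n) f ζ) :
    ∀ᶠ ζ in 𝓝 (z (n + 1)), X n n ζ =
      gridSum q X V (n + 1) ζ + conv (z (n + 1)) (X n n) f ζ := by
  have hXn : DifferentiableOn ℂ (X n n) (ball (z n) κ) := by
    have := (hX n le_rfl).diff n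
    rwa [g.diag n n le_rfl] at this
  have hfκ := hf.mono (ball_subset_ball (by linarith : κ ≤ 2 * κ))
  -- The germ equation at `z n` spreads to the whole disc of radius `κ`, which contains a
  -- neighbourhood of `z (n + 1)`.
  have hball : EqOn (X n n) (fun ζ => gridSum q X V n ζ + conv (z n) (X n n) f ζ)
      (ball (z n) κ) := by
    refine eqOn_of_eventuallyEq isOpen_ball (convex_ball _ _) hXn ?_ (mem_ball_self hκ) h
    exact (g.differentiableOn_gridSum hκ hV fun i hi => hX i hi.le).add
      (differentiableOn_conv hXn hfκ)
  filter_upwards [ball_mem_nhds (z (n + 1)) (by linarith : 0 < κ / 4)] with ζ hζ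
  have hζ1 := mem_ball_iff_norm.1 hζ
  have hb := g.base n
  have hζ0 : ‖ζ - z n‖ < κ / 4 + κ / 16 := by
    have : ζ - z n = (ζ - z (n + 1)) + (z (n + 1) - z n) := by ring
    rw [this]
    linarith [norm_add_le (ζ - z (n + 1)) (z (n + 1) - z n)]
  rw [hball (mem_ball_iff_norm.2 (by linarith) : ζ ∈ ball (z n) κ)]
  -- the last arc, next to the moving end point
  set D := ball (z n) (κ / 2) with hD
  have d0 : z n ∈ D := mem_ball_self (by linarith)
  have d1 : z (n + 1) ∈ D := mem_ball_iff_norm.2 (by linarith)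
  have d2 : ζ ∈ D := mem_ball_iff_norm.2 (by linarith)
  have hsub : ∀ u ∈ D, ‖ζ - u‖ < κ := by
    intro u hu
    have hu' := mem_ball_iff_norm.1 hu
    have : ζ - u = (ζ - z n) - (u - z n) := by ring
    rw [this]
    linarith [norm_sub_le (ζ - z n) (u - z n)]
  have hΦ : DifferentiableOn ℂ (fun u => X n n u * f (ζ - u)) D := by
    refine DifferentiableOn.mul (hXn.mono (ball_subset_ball (by linarith))) ?_
    exact hf.comp (by fun_prop) fun u hu => mem_ball_zero_iff.2 (by linarith [hsub u hu])
  obtain ⟨Q, hQ⟩ := exists_primitive_lineInt hΦ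
  have e1 : lineInt (fun u => X n (n + 1) u * V n (n + 1) (ζ - u)) (q n (n + 1))
      (q (n + 1) (n + 1)) = Q (z (n + 1)) - Q (z n) := by
    rw [g.stay, g.diag (n + 1) (n + 1) le_rfl, ← hQ _ d0 _ d1]
    refine lineInt_congr (convex_ball _ _) d0 d1 fun u hu => ?_
    have hu' := mem_ball_iff_norm.1 hu
    have hub : u ∈ ball (z n) κ := mem_ball_iff_norm.2 (by linarith)
    have x1 := (hX n le_rfl).eqOn_succ n (by linarith [g.time n n])
      (x := u) ⟨by rwa [g.stay], by rwa [g.diag n n le_rfl]⟩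
    have m1 : ζ - u ∈ ball (z n - q n n) (2 * κ) := by
      rw [g.diag n n le_rfl, sub_self, mem_ball_zero_iff]
      linarith [hsub u hu]
    have m2 : ζ - u ∈ ball (z (n + 1) - q n (n + 1)) (2 * κ) := by
      rw [g.stay, mem_ball_iff_norm]
      linarith [norm_sub_le (ζ - u) (z (n + 1) - z n), hsub u hu]
    have x2 := (hV n).eqOn_succ n (by linarith [g.time' n n]) ⟨m2, m1⟩
    have x3 := g.V_eqOn hκ hf hV n n le_rfl
      (mem_ball_zero_iff.2 (by linarith [hsub u hu]) : ζ - u ∈ ball (0 : ℂ) (2 * κ))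
    simp only [x1, x2, x3]
  have e2 : V 0 (n + 1) ζ = V 0 n ζ := by
    refine (hV 0).eqOn_succ n (by linarith [g.time' 0 n]) ⟨?_, ?_⟩
    · rw [g.left, sub_zero, mem_ball_iff_norm]; linarith
    · rw [g.left, sub_zero, mem_ball_iff_norm]; linarith
  have e3 : ∑ i ∈ Finset.range n, lineInt (fun u => X i (n + 1) u * V i (n + 1) (ζ - u))
      (q i (n + 1)) (q (i + 1) (n + 1)) = ∑ i ∈ Finset.range n,
        lineInt (fun u => X i n u * V i n (ζ - u)) (q i n) (q (i + 1) n) := by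
    -- By `Grid.cell` the differences telescope. Both end terms vanish: trajectory `0` stays at `0`,
    -- and trajectory `n` does not move between times `n` and `n + 1`.
    rw [← sub_eq_zero, ← Finset.sum_sub_distrib]
    rw [Finset.sum_congr rfl fun i hi => g.cell hκ hV (hX i (Finset.mem_range.1 hi).le)
      (hX (i + 1) (Finset.mem_range.1 hi)) hζ]
    rw [Finset.sum_range_sub fun i =>
      lineInt (fun u => X i n u * V i n (ζ - u)) (q i n) (q i (n + 1))]
    rw [g.left, g.left, lineInt_self, g.diag n n le_rfl, g.stay, lineInt_self, sub_zero]
  simp only [gridSum, conv]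
  rw [Finset.sum_range_succ, e3, e2, e1, hQ _ d0 _ d2, hQ _ d1 _ d2]
  abel

/-- Propagates the convolution equation along the diagonal by `Grid.transfer`. At each step `X m m`
may be replaced by `X (m + 1) (m + 1)`, since trajectories `m` and `m + 1` agree up to time `m`. -/
theorem Grid.equation (g : Grid z q (κ / 16)) (hκ : 0 < κ)
    (hf : DifferentiableOn ℂ f (ball 0 (2 * κ)))
    (hχ : ∀ᶠ ζ in 𝓝 0, χ ζ = f ζ + conv 0 χ f ζ)
    (hV : ∀ i, ContAlong f (fun j => z j - q i j) (2 * κ) (V i))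
    (hX : ∀ i ≤ n, ContAlong χ (q i) κ (X i)) :
    ∀ m ≤ n, ∀ᶠ ζ in 𝓝 (z m), X m m ζ = gridSum q X V m ζ + conv (z m) (X m m) f ζ := by
  intro m
  induction m with
  | zero =>
    intro _
    rw [g.zero]
    filter_upwards [hχ, (hX 0 (Nat.zero_le _)).start, (hV 0).start,
      conv_congr_eventually (V := f) (hX 0 (Nat.zero_le _)).start] with ζ h1 h2 h3 h4
    rw [h2, h4, h1]
    simp [gridSum, h3]
  | succ m ih =>
    intro hm
    have h1 := g.transfer hκ hf hV (fun i hi => hX i (by omega)) (ih (by omega))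
    have hXm := hX (m + 1) hm
    have hb := g.base m
    have e : X (m + 1) (m + 1) =ᶠ[𝓝 (z (m + 1))] X m m := by
      have e1 := hXm.step m
      rw [g.diag (m + 1) (m + 1) le_rfl] at e1
      refine e1.trans ?_
      have e2 := g.X_near hκ (hX m (by omega)) hXm m
      rw [g.diag m m le_rfl, g.diag (m + 1) m (Nat.le_succ _), inter_self] at e2
      exact (e2.eventuallyEq_of_mem (isOpen_ball.mem_nhds
        (mem_ball_iff_norm.2 (by linarith)))).symm
    filter_upwards [h1, e, conv_congr_eventually (V := f) e] with ζ h2 h3 h4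
    rw [h3, h4, h2]

/-- The continuation of the solution extends to a disc of fixed radius at the next point. -/
theorem Grid.extend (g : Grid z q (κ / 16)) (hκ : 0 < κ)
    (hf : DifferentiableOn ℂ f (ball 0 (2 * κ))) {M : ℝ} (hM : ∀ u ∈ ball (0 : ℂ) κ, ‖f u‖ ≤ M)
    (hκM : κ * M ≤ 1 / 2)
    (hχ : ∀ᶠ ζ in 𝓝 0, χ ζ = f ζ + conv 0 χ f ζ)
    (hV : ∀ i, ContAlong f (fun j => z j - q i j) (2 * κ) (V i))
    (hX : ∀ i ≤ n, ContAlong χ (q i) κ (X i)) :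
    ∃ Y : ℂ → A, DifferentiableOn ℂ Y (ball (z (n + 1)) κ) ∧ Y =ᶠ[𝓝 (z (n + 1))] X n n := by
  have hfκ := hf.mono (ball_subset_ball (by linarith : κ ≤ 2 * κ))
  -- The smallness condition `κ * M ≤ 1 / 2` involves only `f` near `0`, so the radius does not
  -- shrink as `n` grows.
  obtain ⟨Y, hY, eY⟩ := exists_volterra
    (g.differentiableOn_gridSum (n := n + 1) hκ hV fun i hi => hX i (by omega)) hfκ hM hκM
  refine ⟨Y, hY, ?_⟩
  have h := g.transfer hκ hf hV hX (g.equation hκ hf hχ hV hX n le_rfl)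
  have hXn := (hX n le_rfl).diff n
  rw [g.diag n n le_rfl] at hXn
  have hzn : z (n + 1) ∈ ball (z n) κ := mem_ball_iff_norm.2 (by linarith [g.base n])
  obtain ⟨r, hr, hb⟩ := Metric.eventually_nhds_iff_ball.1
    (h.and (isOpen_ball.mem_nhds hzn))
  have hM0 : 0 ≤ M := (norm_nonneg _).trans (hM 0 (mem_ball_self hκ))
  set R := min r κ with hR
  have hR0 : 0 < R := lt_min hr hκ
  have hRr : ball (z (n + 1)) R ⊆ ball (z (n + 1)) r := ball_subset_ball (min_le_left _ _)
  have hRκ : ∀ c : ℂ, ball c R ⊆ ball c κ := fun c => ball_subset_ball (min_le_right _ _)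
  -- On this smaller disc `Y` and `X n n` solve the same Volterra equation.
  refine EqOn.eventuallyEq_of_mem ?_ (ball_mem_nhds _ hR0)
  exact eqOn_of_volterra (hY.continuousOn.mono (hRκ _))
    (hXn.continuousOn.mono fun u hu => (hb u (hRr hu)).2)
    (hfκ.continuousOn.mono (hRκ _)) (fun u hu => hM u (hRκ _ hu))
    ((mul_le_mul_of_nonneg_right (min_le_right _ _) hM0).trans hκM)
    (fun u hu => eY u (hRκ _ hu)) (fun u hu => (hb u (hRr hu)).1)

end Grid

/-! ### Chains with recorded length, margins and cutoffs -/

/-- The point `p` of `ℝ × ℂ` is at distance at least `ε` from `S`. -/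
def Margin (S : Set (ℝ × ℂ)) (ε : ℝ) (p : ℝ × ℂ) : Prop := ∀ s ∈ S, ε ≤ dist p s

theorem Margin.mono {S S' : Set (ℝ × ℂ)} {ε ε' : ℝ} {p : ℝ × ℂ} (h : Margin S ε p) (hS : S' ⊆ S)
    (hε : ε' ≤ ε) : Margin S' ε' p := fun s hs => hε.trans (h s (hS hs))

theorem Margin.of_norm_sub_le {S : Set (ℝ × ℂ)} {a b c : ℝ} {p p' : ℝ × ℂ} (h : Margin S a p)
    (hd : ‖p' - p‖ ≤ b) (hc : c + b ≤ a) : Margin S c p' := by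
  intro s hs
  have := dist_triangle p p' s
  rw [dist_comm p p', dist_eq_norm p' p] at this
  linarith [h s hs]

/-- A chain of points of `ℂ`, each with an upper bound of the length travelled so far. -/
structure IsChain (p : ℕ → ℝ × ℂ) : Prop where
  zero : p 0 = 0
  step : ∀ j, ‖(p (j + 1)).2 - (p j).2‖ ≤ (p (j + 1)).1 - (p j).1

theorem IsChain.norm_step {p : ℕ → ℝ × ℂ} (h : IsChain p) (j : ℕ) :
    ‖p (j + 1) - p j‖ = (p (j + 1)).1 - (p j).1 := by
  have h1 := h.step j
  have h2 : 0 ≤ (p (j + 1)).1 - (p j).1 := (norm_nonneg _).trans h1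
  rw [Prod.norm_def, Prod.fst_sub, Prod.snd_sub, Real.norm_of_nonneg h2, max_eq_left h1]

theorem IsChain.monotone {p : ℕ → ℝ × ℂ} (h : IsChain p) : Monotone fun j => (p j).1 :=
  monotone_nat_of_le_succ fun j => by linarith [(norm_nonneg _).trans (h.step j)]

theorem IsChain.nonneg {p : ℕ → ℝ × ℂ} (h : IsChain p) (j : ℕ) : 0 ≤ (p j).1 := by
  have := h.monotone (Nat.zero_le j)
  simpa [h.zero] using this

theorem IsChain.of_smul {p w : ℕ → ℝ × ℂ} (h : IsChain p) (h0 : w 0 = 0)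
    (hw : ∀ j, ∃ c : ℝ, 0 ≤ c ∧ w (j + 1) - w j = c • (p (j + 1) - p j)) : IsChain w := by
  refine ⟨h0, fun j => ?_⟩
  obtain ⟨c, hc, e⟩ := hw j
  rw [← Prod.fst_sub, ← Prod.snd_sub, e, Prod.smul_fst, Prod.smul_snd, norm_smul,
    Real.norm_of_nonneg hc, smul_eq_mul]
  exact mul_le_mul_of_nonneg_left (h.step j) hc

/-- `f` can be continued, on discs of fixed radius, along all sufficiently fine chains of length
at most `Λ` that keep a given distance from `S`. -/
def ChainCont {E : Type*} [NormedAddCommGroup E] [NormedSpace ℂ E] (S : Set (ℝ × ℂ)) (f : ℂ → E)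
    (Λ : ℝ) : Prop :=
  ∀ ε > 0, ∃ κ > 0, ∀ p : ℕ → ℝ × ℂ, IsChain p → (∀ j, (p (j + 1)).1 - (p j).1 < κ) →
    (∀ j, Margin S ε (p j)) → (∀ j, (p j).1 ≤ Λ) → ∃ X, ContAlong f (fun j => (p j).2) κ X

/-- A thickened indicator of the `e`-neighbourhood of `S`. The last two properties are the ones
driving the flow: `θ ≠ 0` means close to `S`, `θ ≠ 1` means a safe distance from `S`. -/
theorem exists_cutoff (S : Set (ℝ × ℂ)) {e : ℝ} (he : 0 < e) : ∃ θ : ℝ × ℂ → ℝ,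
    (∀ p, 0 ≤ θ p) ∧ (∀ p, θ p ≤ 1) ∧ (∀ p q, |θ p - θ q| ≤ e⁻¹ * ‖p - q‖) ∧
    (∀ p, θ p ≠ 0 → ∃ s ∈ S, dist p s < 2 * e) ∧ (∀ p, θ p ≠ 1 → Margin S e p) := by
  refine ⟨fun p => (thickenedIndicator he (thickening e S) p : ℝ), fun p => NNReal.coe_nonneg _,
    fun p => ?_, fun p q => ?_, fun p hp => ?_, fun p hp => ?_⟩
  · exact_mod_cast thickenedIndicator_le_one he (thickening e S) p
  · have := (lipschitzWith_thickenedIndicator he (thickening e S)).dist_le_mul p q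
    rw [NNReal.dist_eq, dist_eq_norm p q, NNReal.coe_inv, Real.coe_toNNReal e he.le] at this
    exact this
  · by_contra hS
    push Not at hS
    refine hp ?_
    beta_reduce
    rw [thickenedIndicator_zero he (thickening e S)]
    · rfl
    · intro hmem
      obtain ⟨x, hx, hpx⟩ := mem_thickening_iff.1 hmem
      obtain ⟨s, hs, hxs⟩ := mem_thickening_iff.1 hx
      linarith [hS s hs, dist_triangle p x s]
  · intro s hs
    by_contra hlt
    push Not at hlt
    refine hp ?_
    beta_reduce
    rw [thickenedIndicator_one he (thickening e S) (mem_thickening_iff.2 ⟨s, hs, hlt⟩)]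
    rfl

/-! ### The discrete flow that shares each step between the two factors -/

section Flow

variable {S T : Set (ℝ × ℂ)} {e : ℝ} {θ : ℝ × ℂ → ℝ} {p : ℕ → ℝ × ℂ}

/-- The discrete flow driven by the chain `p`, slowed down by the cutoff `θ`; the `i`-th
trajectory stays at `0` until time `i`. -/
def flow (θ : ℝ × ℂ → ℝ) (p : ℕ → ℝ × ℂ) (i : ℕ) : ℕ → ℝ × ℂ
  | 0 => 0
  | j + 1 => if j < i then 0 else flow θ p i j + (1 - θ (flow θ p i j)) • (p (j + 1) - p j)

theorem flow_of_le {i j : ℕ} (h : j ≤ i) : flow θ p i j = 0 := by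
  cases j with
  | zero => rfl
  | succ j => rw [flow, if_pos (by omega)]

theorem flow_succ {i j : ℕ} (h : i ≤ j) :
    flow θ p i (j + 1) = flow θ p i j + (1 - θ (flow θ p i j)) • (p (j + 1) - p j) := by
  rw [flow, if_neg (by omega)]

theorem flow_step (h0 : ∀ x, 0 ≤ θ x) (h1 : ∀ x, θ x ≤ 1) (i j : ℕ) :
    ∃ c : ℝ, 0 ≤ c ∧ c ≤ 1 ∧ flow θ p i (j + 1) - flow θ p i j = c • (p (j + 1) - p j) ∧
      (c ≠ 0 → θ (flow θ p i j) ≠ 1) := by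
  rcases lt_or_ge j i with h | h
  · exact ⟨0, le_rfl, zero_le_one, by rw [flow_of_le h, flow_of_le h.le]; simp, by simp⟩
  · refine ⟨1 - θ (flow θ p i j), by linarith [h1 (flow θ p i j)],
      by linarith [h0 (flow θ p i j)], ?_, ?_⟩
    · rw [flow_succ h]; simp
    · intro hc h'
      exact hc (by rw [h', sub_self])

theorem isChain_flow (hp : IsChain p) (h0 : ∀ x, 0 ≤ θ x) (h1 : ∀ x, θ x ≤ 1) (i : ℕ) :
    IsChain (flow θ p i) := by
  refine hp.of_smul rfl fun j => ?_
  obtain ⟨c, hc, -, h, -⟩ := flow_step (p := p) h0 h1 i j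
  exact ⟨c, hc, h⟩

theorem isChain_sub_flow (hp : IsChain p) (h0 : ∀ x, 0 ≤ θ x) (h1 : ∀ x, θ x ≤ 1) (i : ℕ) :
    IsChain fun j => p j - flow θ p i j := by
  refine hp.of_smul (by simp [hp.zero, flow]) fun j => ?_
  obtain ⟨c, -, hc, h, -⟩ := flow_step (p := p) h0 h1 i j
  refine ⟨1 - c, by linarith, ?_⟩
  rw [sub_sub_sub_comm, h, sub_smul, one_smul]

theorem flow_fst_le (hp : IsChain p) (h0 : ∀ x, 0 ≤ θ x) (h1 : ∀ x, θ x ≤ 1) (i j : ℕ) :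
    (flow θ p i j).1 ≤ (p j).1 := by
  have := (isChain_sub_flow hp h0 h1 i).nonneg j
  simpa using this

theorem norm_flow_step_le (hp : IsChain p) (h0 : ∀ x, 0 ≤ θ x) (h1 : ∀ x, θ x ≤ 1) (i j : ℕ) :
    ‖flow θ p i (j + 1) - flow θ p i j‖ ≤ (p (j + 1)).1 - (p j).1 := by
  obtain ⟨c, hc, hc1, h, -⟩ := flow_step (p := p) h0 h1 i j
  rw [h, norm_smul, Real.norm_of_nonneg hc, hp.norm_step]
  exact mul_le_of_le_one_left ((norm_nonneg _).trans (hp.step j)) hc1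

theorem norm_sub_flow_step_le (hp : IsChain p) (h0 : ∀ x, 0 ≤ θ x) (h1 : ∀ x, θ x ≤ 1)
    (i j : ℕ) : ‖(p (j + 1) - flow θ p i (j + 1)) - (p j - flow θ p i j)‖ ≤
      (p (j + 1)).1 - (p j).1 := by
  obtain ⟨c, hc, hc1, h, -⟩ := flow_step (p := p) h0 h1 i j
  have : (p (j + 1) - flow θ p i (j + 1)) - (p j - flow θ p i j) =
      (1 - c) • (p (j + 1) - p j) := by
    rw [sub_sub_sub_comm, h, sub_smul, one_smul]
  rw [this, norm_smul, Real.norm_of_nonneg (by linarith), hp.norm_step]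
  exact mul_le_of_le_one_left ((norm_nonneg _).trans (hp.step j)) (by linarith)

/-- A trajectory moves only where `θ ≠ 1`, that is, at distance at least `e` from `S`, and a single
step is too short to use up more than half of that. -/
theorem margin_flow (hp : IsChain p) (h0 : ∀ x, 0 ≤ θ x) (h1 : ∀ x, θ x ≤ 1)
    (hm : ∀ x, θ x ≠ 1 → Margin S e x) (hS : Margin S e 0) (he : 0 < e)
    (hs : ∀ j, (p (j + 1)).1 - (p j).1 ≤ e / 2) (i j : ℕ) : Margin S (e / 2) (flow θ p i j) := by
  induction j with
  | zero => exact hS.mono subset_rfl (by linarith)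
  | succ j ih =>
    obtain ⟨c, -, -, h, hc⟩ := flow_step (p := p) h0 h1 i j
    by_cases hc0 : c = 0
    · rw [hc0, zero_smul, sub_eq_zero] at h
      rwa [h]
    · exact (hm _ (hc hc0)).of_norm_sub_le
        ((norm_flow_step_le hp h0 h1 i j).trans (hs j)) (by linarith)

/-- The complementary point moves only when the flow is within `2 * e` of some `s ∈ S`. Since `p j`
is at distance at least `4 * e` from `s + t ∈ T`, the complementary point is then at least `2 * e`
away from every `t ∈ T`, and one step costs at most `e`. -/
theorem margin_sub_flow (hp : IsChain p) (h0 : ∀ x, 0 ≤ θ x) (h1 : ∀ x, θ x ≤ 1)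
    (hn : ∀ x, θ x ≠ 0 → ∃ s ∈ S, dist x s < 2 * e) (hadd : ∀ s ∈ S, ∀ t ∈ T, s + t ∈ T)
    (he : 0 < e) (hs : ∀ j, (p (j + 1)).1 - (p j).1 ≤ e) (hT : ∀ j, Margin T (4 * e) (p j))
    (i j : ℕ) : Margin T e (p j - flow θ p i j) := by
  induction j with
  | zero =>
    rw [flow_of_le (Nat.zero_le _), sub_zero]
    exact (hT 0).mono subset_rfl (by linarith)
  | succ j ih =>
    rcases lt_or_ge j i with h | h
    · rw [flow_of_le h, sub_zero]
      exact (hT _).mono subset_rfl (by linarith)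
    · by_cases hθ : θ (flow θ p i j) = 0
      · have : p (j + 1) - flow θ p i (j + 1) = p j - flow θ p i j := by
          rw [flow_succ h, hθ, sub_zero, one_smul]; abel
        rwa [this]
      · obtain ⟨s, hsS, hd⟩ := hn _ hθ
        have hm : Margin T (2 * e) (p j - flow θ p i j) := by
          intro t ht
          have h3 := hT j _ (hadd s hsS t ht)
          have h4 := dist_add_add_le (flow θ p i j) (p j - flow θ p i j) s t
          rw [add_sub_cancel] at h4
          linarith
        exact hm.of_norm_sub_le ((norm_sub_flow_step_le hp h0 h1 i j).trans (hs j))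
          (by linarith)

/-- The trajectory started at time `0` is never slowed down along `p`, which pins the initial point
of every contour at `0`. -/
theorem flow_zero_index (hp : IsChain p) (hθ : ∀ j, θ (p j) = 0) (j : ℕ) :
    flow θ p 0 j = p j := by
  induction j with
  | zero => rw [hp.zero]; rfl
  | succ j ih => rw [flow_succ (Nat.zero_le _), ih, hθ, sub_zero, one_smul]; abel

/-- A discrete Grönwall estimate: two trajectories started one step apart begin at distance at most
`κ`, and the Lipschitz constant `e⁻¹` of `θ` makes them separate at most exponentially in the length
of `p`. -/
theorem norm_flow_index_le (hp : IsChain p)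
    (hL : ∀ x y, |θ x - θ y| ≤ e⁻¹ * ‖x - y‖) (he : 0 < e) (hθ0 : θ 0 = 0) {κ : ℝ}
    (hκ : 0 ≤ κ) (hs : ∀ j, (p (j + 1)).1 - (p j).1 ≤ κ) (i j : ℕ) :
    ‖flow θ p (i + 1) j - flow θ p i j‖ ≤ κ * Real.exp (e⁻¹ * (p j).1) := by
  induction j with
  | zero => simp only [flow, sub_self, norm_zero]; positivity
  | succ j ih =>
    have hΔ : 0 ≤ (p (j + 1)).1 - (p j).1 := (norm_nonneg _).trans (hp.step j)
    rcases lt_trichotomy j i with h | h | h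
    · rw [flow_of_le (by omega), flow_of_le (by omega), sub_self, norm_zero]; positivity
    · subst h
      rw [flow_of_le le_rfl, flow_succ le_rfl, flow_of_le le_rfl, hθ0, zero_add, sub_zero, one_smul,
        zero_sub, norm_neg, hp.norm_step]
      refine (hs j).trans (le_mul_of_one_le_right hκ (Real.one_le_exp ?_))
      exact mul_nonneg (inv_nonneg.2 he.le) (hp.nonneg _)
    · rw [flow_succ (by omega : i + 1 ≤ j), flow_succ h.le]
      set a := flow θ p (i + 1) j
      set b := flow θ p i j
      have e1 : a + (1 - θ a) • (p (j + 1) - p j) - (b + (1 - θ b) • (p (j + 1) - p j)) =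
          (a - b) - (θ a - θ b) • (p (j + 1) - p j) := by module
      have e2 : (p (j + 1)).1 = (p j).1 + ((p (j + 1)).1 - (p j).1) := by ring
      rw [e1]
      calc _ ≤ ‖a - b‖ + ‖(θ a - θ b) • (p (j + 1) - p j)‖ := norm_sub_le _ _
        _ ≤ ‖a - b‖ + e⁻¹ * ‖a - b‖ * ((p (j + 1)).1 - (p j).1) := by
          rw [norm_smul, hp.norm_step, Real.norm_eq_abs]
          gcongr
          exact hL a b
        _ = ‖a - b‖ * (e⁻¹ * ((p (j + 1)).1 - (p j).1) + 1) := by ring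
        _ ≤ κ * Real.exp (e⁻¹ * (p j).1) * Real.exp (e⁻¹ * ((p (j + 1)).1 - (p j).1)) := by
          gcongr
          exact Real.add_one_le_exp _
        _ = κ * Real.exp (e⁻¹ * (p (j + 1)).1) := by
          rw [mul_assoc, ← Real.exp_add, ← mul_add, ← e2]

/-- The gain in length. The complementary point moves past time `i` only after the flow has length
more than `d`, and what remains of a total `Λ + d` is at most `Λ`. -/
theorem sub_flow_fst_le (hp : IsChain p) (h0 : ∀ x, 0 ≤ θ x) (h1 : ∀ x, θ x ≤ 1) {d Λ : ℝ}
    (hd : ∀ x : ℝ × ℂ, x.1 ≤ d → θ x = 0)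
    (hΛ : ∀ j, (p j).1 ≤ Λ + d) {i : ℕ} (hi : (p i).1 ≤ Λ) (j : ℕ) :
    (p j - flow θ p i j).1 ≤ Λ := by
  induction j with
  | zero =>
    rw [flow_of_le (Nat.zero_le _), sub_zero]
    exact (hp.monotone (Nat.zero_le i)).trans hi
  | succ j ih =>
    rcases lt_or_ge j i with h | h
    · rw [flow_of_le h, sub_zero]
      exact (hp.monotone (Nat.succ_le_of_lt h)).trans hi
    · by_cases hθ : θ (flow θ p i j) = 0
      · have : p (j + 1) - flow θ p i (j + 1) = p j - flow θ p i j := by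
          rw [flow_succ h, hθ, sub_zero, one_smul]; abel
        rwa [this]
      · have h2 : d < (flow θ p i j).1 := by
          by_contra hle
          exact hθ (hd _ (not_lt.1 hle))
        have h3 := (isChain_flow hp h0 h1 i).monotone (Nat.le_succ j)
        simp only at h3
        rw [Prod.fst_sub]
        linarith [hΛ (j + 1)]

/-- If `p` has at most length `d` left after time `i`, the flow never leaves the region where `θ =
0`, hence receives every step in full. -/
theorem sub_flow_eq_of_late {d : ℝ}
    (hd : ∀ x : ℝ × ℂ, x.1 ≤ d → θ x = 0) {i : ℕ} (hi : ∀ j, (p j).1 - (p i).1 ≤ d) (j : ℕ)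
    (hj : i ≤ j) : p j - flow θ p i j = p i := by
  induction j, hj using Nat.le_induction with
  | base => rw [flow_of_le le_rfl, sub_zero]
  | succ j hj ih =>
    have h1 : flow θ p i j = p j - p i := by rw [← ih]; abel
    have h2 : θ (flow θ p i j) = 0 := hd _ (by rw [h1]; exact hi j)
    rw [flow_succ hj, h2, sub_zero, one_smul, h1]
    abel

end Flow

/-! ### Continuation of the resolvent by induction on length -/

section Resolvent

variable {A : Type*} [NormedRing A] [NormedAlgebra ℂ A] [CompleteSpace A]

/-- Trajectories are treated in order. One along which `χ` is already continuable needs no work. One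
frozen from time `n + 1` on coincides with `z` up to then, so trajectory `n` supplies its past and
`Grid.extend` its final disc. -/
theorem Grid.exists_family {z : ℕ → ℂ} {q : ℕ → ℕ → ℂ} {κ : ℝ} {f χ : ℂ → A}
    {V : ℕ → ℕ → ℂ → A} (g : Grid z q (κ / 16)) (hκ : 0 < κ)
    (hf : DifferentiableOn ℂ f (ball 0 (2 * κ))) {M : ℝ} (hM : ∀ u ∈ ball (0 : ℂ) κ, ‖f u‖ ≤ M)
    (hκM : κ * M ≤ 1 / 2) (hχd : DifferentiableOn ℂ χ (ball 0 κ))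
    (hχ : ∀ᶠ ζ in 𝓝 0, χ ζ = f ζ + conv 0 χ f ζ)
    (hV : ∀ i, ContAlong f (fun j => z j - q i j) (2 * κ) (V i))
    (hq : ∀ i, (∃ Y, ContAlong χ (q i) κ Y) ∨ ∀ j, i ≤ j → q i j = z i) (n : ℕ) :
    ∃ X : ℕ → ℕ → ℂ → A, ∀ i ≤ n, ContAlong χ (q i) κ (X i) := by
  induction n with
  | zero =>
    refine ⟨fun _ _ => χ, fun i hi => ?_⟩
    rw [Nat.le_zero.1 hi]
    refine ⟨fun j => ?_, EventuallyEq.rfl, fun j => EventuallyEq.rfl⟩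
    rwa [g.left]
  | succ n ih =>
    obtain ⟨X, hX⟩ := ih
    suffices h : ∃ Y, ContAlong χ (q (n + 1)) κ Y by
      obtain ⟨Y, hY⟩ := h
      refine ⟨fun i => if i ≤ n then X i else Y, fun i hi => ?_⟩
      by_cases h : i ≤ n
      · simpa only [if_pos h] using hX i h
      · simp only [if_neg h]
        rwa [show i = n + 1 by omega]
    rcases hq (n + 1) with h | h
    · exact h
    obtain ⟨Y, hY, eY⟩ := g.extend hκ hf hM hκM hχ hV hX
    have hXn := hX n le_rfl
    refine ⟨fun j => if j ≤ n then X n j else Y, fun j => ?_, ?_, fun j => ?_⟩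
    · by_cases hj : j ≤ n
      · simp only [if_pos hj]
        rw [g.diag (n + 1) j (by omega), ← g.diag n j hj]
        exact hXn.diff j
      · simp only [if_neg hj]
        rwa [h j (by omega)]
    · simpa using hXn.start
    · rcases lt_trichotomy j n with hj | hj | hj
      · simp only [if_pos hj.le, if_pos (Nat.succ_le_of_lt hj)]
        rw [g.diag (n + 1) (j + 1) (by omega), ← g.diag n (j + 1) hj]
        exact hXn.step j
      · subst hj
        simp only [le_refl, if_true, if_neg (by omega : ¬ j + 1 ≤ j)]
        rwa [h _ le_rfl]
      · simp only [if_neg (by omega : ¬ j ≤ n), if_neg (by omega : ¬ j + 1 ≤ n)]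
        exact EventuallyEq.rfl

/-- Takes the diagonal, where `q j j = z j`. The families chosen for different `j` need not be
related; continuations along neighbouring chains agree anyway. -/
theorem Grid.exists_contAlong {z : ℕ → ℂ} {q : ℕ → ℕ → ℂ} {κ : ℝ} {χ : ℂ → A}
    (g : Grid z q (κ / 16)) (hκ : 0 < κ)
    (h : ∀ n, ∃ X : ℕ → ℕ → ℂ → A, ∀ i ≤ n, ContAlong χ (q i) κ (X i)) :
    ∃ X, ContAlong χ z κ X := by
  choose X hX using h
  have hd := fun j => hX j j le_rfl
  refine ⟨fun j => X j j j, fun j => ?_, (hd 0).start, fun j => ?_⟩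
  · rw [← g.diag j j le_rfl]
    exact (hd j).diff j
  · have e1 := (hd (j + 1)).step j
    rw [g.diag (j + 1) (j + 1) le_rfl] at e1
    refine e1.trans ?_
    have e2 := g.X_near hκ (hd j) (hd (j + 1)) j
    rw [g.diag j j le_rfl, g.diag (j + 1) j (Nat.le_succ _), inter_self] at e2
    exact (e2.eventuallyEq_of_mem (isOpen_ball.mem_nhds
      (mem_ball_iff_norm.2 (by linarith [g.base j])))).symm

theorem grid_of_flow {p : ℕ → ℝ × ℂ} {θ : ℝ × ℂ → ℝ} {e η κ : ℝ} (hp : IsChain p)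
    (h0 : ∀ x, 0 ≤ θ x) (h1 : ∀ x, θ x ≤ 1) (hL : ∀ x y, |θ x - θ y| ≤ e⁻¹ * ‖x - y‖)
    (he : 0 < e) (hθp : ∀ j, θ (p j) = 0) (hκ : 0 ≤ κ)
    (hs : ∀ j, (p (j + 1)).1 - (p j).1 ≤ κ) (hκη : ∀ j, κ * Real.exp (e⁻¹ * (p j).1) < η) :
    Grid (fun j => (p j).2) (fun i j => (p j - flow θ p i j).2) η := by
  have hθ0 : θ 0 = 0 := by rw [← hp.zero, hθp]
  have hη : κ < η := by simpa [hp.zero] using hκη 0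
  refine ⟨fun j => ?_, fun i j h => ?_, fun i => ?_, fun i j => ?_, fun i j => ?_, fun i j => ?_⟩
  · simp [flow_zero_index hp hθp]
  · simp [flow_of_le h]
  · simp [flow_succ le_rfl, flow_of_le le_rfl, hθ0]
  · refine ((norm_snd_le _).trans (norm_sub_flow_step_le hp h0 h1 i j)).trans_lt ?_
    linarith [hs j]
  · have e1 : (p (j + 1)).2 - (p (j + 1) - flow θ p i (j + 1)).2 -
        ((p j).2 - (p j - flow θ p i j).2) = (flow θ p i (j + 1) - flow θ p i j).2 := by
      simp
    simp only [e1]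
    refine ((norm_snd_le _).trans (norm_flow_step_le hp h0 h1 i j)).trans_lt ?_
    linarith [hs j]
  · have e1 : (p j - flow θ p (i + 1) j).2 - (p j - flow θ p i j).2 =
        -(flow θ p (i + 1) j - flow θ p i j).2 := by
      simp
    simp only [e1, norm_neg]
    exact ((norm_snd_le _).trans (norm_flow_index_le hp hL he hθ0 hκ hs i j)).trans_lt (hκη j)

/-- If `f` is continuable outside `S` and `χ = f + χ * f`, then continuability of `χ` outside `T`
propagates to longer chains, where `T` contains `S` and `S + T`. -/
theorem ChainCont.step {S T : Set (ℝ × ℂ)} {δ : ℝ} (hδ : 0 < δ) (hS : ∀ s ∈ S, δ ≤ s.1)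
    (hST : S ⊆ T) (hadd : ∀ s ∈ S, ∀ t ∈ T, s + t ∈ T) {f χ : ℂ → A} (hf0 : AnalyticAt ℂ f 0)
    (hχ0 : AnalyticAt ℂ χ 0) (hχ : ∀ᶠ ζ in 𝓝 0, χ ζ = f ζ + conv 0 χ f ζ)
    (hf : ∀ Λ, ChainCont S f Λ) {Λ : ℝ} (h : ChainCont T χ Λ) : ChainCont T χ (Λ + δ / 2) := by
  intro ε hε
  -- `4 * e ≤ ε` provides the margin needed in `margin_sub_flow`; `8 * e ≤ δ` makes the cutoff
  -- vanish at all points of length at most `δ / 2`.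
  set e := min (ε / 4) (δ / 8) with he_def
  have he : 0 < e := lt_min (by linarith) (by linarith)
  have heε : 4 * e ≤ ε := by linarith [min_le_left (ε / 4) (δ / 8)]
  have heδ : 8 * e ≤ δ := by linarith [min_le_right (ε / 4) (δ / 8)]
  obtain ⟨κf, hκf, Hf⟩ := hf (Λ + δ / 2) (e / 2) (by linarith)
  obtain ⟨κχ, hκχ, Hχ⟩ := h e he
  obtain ⟨rf, hrf, hfd⟩ := Metric.eventually_nhds_iff_ball.1 hf0.eventually_analyticAt
  obtain ⟨rχ, hrχ, hχd⟩ := Metric.eventually_nhds_iff_ball.1 hχ0.eventually_analyticAt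
  obtain ⟨rM, hrM, hfM⟩ := Metric.eventually_nhds_iff_ball.1
    (hf0.continuousAt.norm.eventually_lt (continuousAt_const (y := ‖f 0‖ + 1)) (lt_add_one _))
  set M := ‖f 0‖ + 1 with hM_def
  have hM : 0 < M := by positivity
  obtain ⟨κ, hκ, hκle⟩ : ∃ κ > 0, κ ≤ κχ ∧ 2 * κ ≤ κf ∧ 2 * κ ≤ rf ∧ κ ≤ rχ ∧ κ ≤ rM ∧
      κ * M ≤ 1 / 2 ∧ κ ≤ e / 2 := by
    have : ∀ᶠ κ in 𝓝[>] (0 : ℝ), κ < κχ ∧ 2 * κ < κf ∧ 2 * κ < rf ∧ κ < rχ ∧ κ < rM ∧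
        κ * M < 1 / 2 ∧ κ < e / 2 := by
      refine nhdsWithin_le_nhds ?_
      have c : ∀ {a b : ℝ}, 0 < b → ∀ᶠ κ in 𝓝 (0 : ℝ), κ * a < b := fun {a b} hb =>
        (continuous_mul_const a).continuousAt.eventually_lt continuousAt_const (by simpa using hb)
      filter_upwards [c (a := 1) hκχ, c (a := 2) hκf, c (a := 2) hrf, c (a := 1) hrχ,
        c (a := 1) hrM, c (a := M) (by norm_num : (0 : ℝ) < 1 / 2),
        c (a := 1) (by linarith : 0 < e / 2)] with κ k1 k2 k3 k4 k5 k6 k7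
      rw [mul_one] at k1 k4 k5 k7
      rw [mul_comm] at k2 k3
      exact ⟨k1, k2, k3, k4, k5, k6, k7⟩
    obtain ⟨κ, hk, hk0⟩ := (this.and self_mem_nhdsWithin).exists
    exact ⟨κ, hk0, hk.1.le, hk.2.1.le, hk.2.2.1.le, hk.2.2.2.1.le, hk.2.2.2.2.1.le,
      hk.2.2.2.2.2.1.le, hk.2.2.2.2.2.2.le⟩
  obtain ⟨k1, k2, k3, k4, k5, k6, k7⟩ := hκle
  -- The mesh must absorb the exponential separation of trajectories in `norm_flow_index_le`. The
  -- absolute value is there because `Λ` may be negative.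
  set L := e⁻¹ * |Λ + δ / 2| with hL_def
  have hL : 0 ≤ L := by positivity
  have hexp : Real.exp (-L) ≤ 1 := Real.exp_le_one_iff.2 (by linarith)
  set κ' := κ / 32 * Real.exp (-L) with hκ'_def
  have hκ' : 0 < κ' := by positivity
  have hκ'κ : κ' ≤ κ / 32 := mul_le_of_le_one_right (by positivity) hexp
  refine ⟨κ', hκ', fun p hp hs hm hΛ => ?_⟩
  obtain ⟨θ, h0, h1, hLip, hn, hmS⟩ := exists_cutoff S he
  have hT : ∀ j, Margin T (4 * e) (p j) := fun j => (hm j).mono subset_rfl heε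
  have hθp : ∀ j, θ (p j) = 0 := by
    intro j
    by_contra hne
    obtain ⟨s, hsS, hd⟩ := hn _ hne
    linarith [hT j s (hST hsS)]
  have hθd : ∀ x : ℝ × ℂ, x.1 ≤ δ / 2 → θ x = 0 := by
    intro x hx
    by_contra hne
    obtain ⟨s, hsS, hd⟩ := hn _ hne
    have h2 : dist x.1 s.1 ≤ dist x s := le_max_left _ _
    rw [Real.dist_eq] at h2
    linarith [neg_abs_le (x.1 - s.1), hS s hsS]
  have hS0 : Margin S e 0 := by
    have := hT 0
    rw [hp.zero] at this
    exact this.mono hST (by linarith)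
  have hs' : ∀ j, (p (j + 1)).1 - (p j).1 ≤ κ' := fun j => (hs j).le
  have g : Grid (fun j => (p j).2) (fun i j => (p j - flow θ p i j).2) (κ / 16) := by
    refine grid_of_flow hp h0 h1 hLip he hθp hκ'.le hs' fun j => ?_
    have h2 : Real.exp (e⁻¹ * (p j).1) ≤ Real.exp L := by
      refine Real.exp_le_exp.2 (mul_le_mul_of_nonneg_left ?_ (inv_nonneg.2 he.le))
      exact (hΛ j).trans (le_abs_self _)
    calc κ' * Real.exp (e⁻¹ * (p j).1) ≤ κ' * Real.exp L :=
          mul_le_mul_of_nonneg_left h2 hκ'.le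
      _ = κ / 32 := by rw [hκ'_def, mul_assoc, ← Real.exp_add]; simp
      _ < κ / 16 := by linarith
  have hfd' : DifferentiableOn ℂ f (ball 0 (2 * κ)) := fun u hu =>
    (hfd u (ball_subset_ball k3 hu)).differentiableAt.differentiableWithinAt
  have hχd' : DifferentiableOn ℂ χ (ball 0 κ) := fun u hu =>
    (hχd u (ball_subset_ball k4 hu)).differentiableAt.differentiableWithinAt
  have hV : ∀ i, ∃ V, ContAlong f (fun j => (p j).2 - (p j - flow θ p i j).2) (2 * κ) V := by
    intro i
    have s1 : ∀ j, (flow θ p i (j + 1)).1 - (flow θ p i j).1 < κf := fun j => by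
      rw [← (isChain_flow hp h0 h1 i).norm_step]
      linarith [norm_flow_step_le hp h0 h1 i j, hs j]
    have s2 : ∀ j, (p (j + 1)).1 - (p j).1 ≤ e / 2 := fun j => by linarith [hs j]
    obtain ⟨V, hV⟩ := Hf (flow θ p i) (isChain_flow hp h0 h1 i) s1
      (margin_flow hp h0 h1 hmS hS0 he s2 i)
      (fun j => (flow_fst_le hp h0 h1 i j).trans (hΛ j))
    refine ⟨V, ?_⟩
    have : (fun j => (p j).2 - (p j - flow θ p i j).2) = fun j => (flow θ p i j).2 := by
      funext j; simp
    rw [this]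
    exact hV.mono k2
  choose V hV using hV
  -- Either the point is created before length `Λ`, and its whole trajectory has length at most `Λ`,
  -- so the hypothesis on `χ` applies; or it is created during the last `δ / 2` and stays frozen.
  have hq : ∀ i, (∃ Y, ContAlong χ (fun j => (p j - flow θ p i j).2) κ Y) ∨
      ∀ j, i ≤ j → (p j - flow θ p i j).2 = (p i).2 := by
    intro i
    rcases le_or_gt (p i).1 Λ with hi | hi
    · left
      have hc := isChain_sub_flow hp h0 h1 i
      have s1 : ∀ j, (p (j + 1) - flow θ p i (j + 1)).1 - (p j - flow θ p i j).1 < κχ :=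
        fun j => by
          rw [← hc.norm_step]
          linarith [norm_sub_flow_step_le hp h0 h1 i j, hs j]
      have s2 : ∀ j, (p (j + 1)).1 - (p j).1 ≤ e := fun j => by linarith [hs j]
      obtain ⟨Y, hY⟩ := Hχ _ hc s1 (margin_sub_flow hp h0 h1 hn hadd he s2 hT i)
        (sub_flow_fst_le hp h0 h1 hθd hΛ hi)
      exact ⟨Y, hY.mono k1⟩
    · right
      intro j hj
      rw [sub_flow_eq_of_late hθd (fun k => ?_) j hj]
      linarith [hΛ k]
  obtain ⟨X, hX⟩ := g.exists_contAlong hκ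
    (g.exists_family hκ hfd' (fun u hu => (hfM u (ball_subset_ball k5 hu)).le) k6 hχd' hχ hV hq)
  exact ⟨X, hX.mono (by linarith)⟩

theorem ChainCont.mono {E : Type*} [NormedAddCommGroup E] [NormedSpace ℂ E] {S S' : Set (ℝ × ℂ)}
    {f : ℂ → E} {Λ Λ' : ℝ} (h : ChainCont S f Λ) (hS : S ⊆ S') (hΛ : Λ' ≤ Λ) :
    ChainCont S' f Λ' := by
  intro ε hε
  obtain ⟨κ, hκ, H⟩ := h ε hε
  exact ⟨κ, hκ, fun p hp hs hm hl =>
    H p hp hs (fun j => (hm j).mono hS le_rfl) fun j => (hl j).trans hΛ⟩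

/-- The resolvent `χ = f + χ * f` of a continuable `f` is continuable. -/
theorem ChainCont.resolvent {S T : Set (ℝ × ℂ)} {δ : ℝ} (hδ : 0 < δ) (hS : ∀ s ∈ S, δ ≤ s.1)
    (hST : S ⊆ T) (hadd : ∀ s ∈ S, ∀ t ∈ T, s + t ∈ T) {f χ : ℂ → A} (hf0 : AnalyticAt ℂ f 0)
    (hχ0 : AnalyticAt ℂ χ 0) (hχ : ∀ᶠ ζ in 𝓝 0, χ ζ = f ζ + conv 0 χ f ζ)
    (hf : ∀ Λ, ChainCont S f Λ) (Λ : ℝ) : ChainCont T χ Λ := by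
  -- Starting from `-1` makes the base case vacuous: every chain begins at length `0`.
  have key : ∀ n : ℕ, ChainCont T χ (-1 + n * (δ / 2)) := by
    intro n
    induction n with
    | zero =>
      intro ε _
      refine ⟨1, one_pos, fun p hp _ _ hl => ?_⟩
      have := hl 0
      rw [hp.zero] at this
      norm_num at this
    | succ n ih =>
      have := ChainCont.step hδ hS hST hadd hf0 hχ0 hχ hf ih
      convert this using 1
      push_cast
      ring
  obtain ⟨n, hn⟩ := exists_nat_gt ((Λ + 1) / (δ / 2))
  rw [div_lt_iff₀ (by linarith)] at hn
  exact (key n).mono subset_rfl (by linarith)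

end Resolvent

/-! ### Families of germs along paths; extension to discs -/

section GermCont

/-- The germs `g t` at `γ t`, for `t ∈ I`, continue each other analytically along `γ`. -/
structure GermCont (γ : ℝ → ℂ) (I : Set ℝ) (g : ℝ → ℂ → ℂ) : Prop where
  analytic : ∀ t ∈ I, AnalyticAt ℂ (g t) (γ t)
  local_eq : ∀ t ∈ I, ∀ᶠ s in 𝓝[I] t, g s =ᶠ[𝓝 (γ s)] g t

theorem GermCont.mono {γ : ℝ → ℂ} {I J : Set ℝ} {g : ℝ → ℂ → ℂ} (h : GermCont γ I g)
    (hJ : J ⊆ I) : GermCont γ J g :=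
  ⟨fun t ht => h.analytic t (hJ ht), fun t ht =>
    (h.local_eq t (hJ ht)).filter_mono (nhdsWithin_mono t hJ)⟩

theorem GermCont.congr {γ γ' : ℝ → ℂ} {I : Set ℝ} {g : ℝ → ℂ → ℂ} (h : GermCont γ I g)
    (he : EqOn γ γ' I) : GermCont γ' I g := by
  refine ⟨fun t ht => he ht ▸ h.analytic t ht, fun t ht => ?_⟩
  filter_upwards [h.local_eq t ht, self_mem_nhdsWithin] with s hs hsI
  rwa [← he hsI]

/-- Two continuations along the same path that agree somewhere agree everywhere. -/
theorem GermCont.unique {γ : ℝ → ℂ} {I : Set ℝ} {g g' : ℝ → ℂ → ℂ} (h : GermCont γ I g)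
    (h' : GermCont γ I g') (hI : IsPreconnected I) (hγ : ContinuousOn γ I) {a t : ℝ} (ha : a ∈ I)
    (ht : t ∈ I) (e : g a =ᶠ[𝓝 (γ a)] g' a) : g t =ᶠ[𝓝 (γ t)] g' t := by
  refine hI.induction₂' (fun s t => g s =ᶠ[𝓝 (γ s)] g' s → g t =ᶠ[𝓝 (γ t)] g' t) ?_
    (fun x y z _ _ _ h1 h2 h3 => h2 (h1 h3)) ha ht e
  intro t ht
  obtain ⟨r, hr, hb⟩ := Metric.eventually_nhds_iff_ball.1
    ((h.analytic t ht).eventually_analyticAt.and (h'.analytic t ht).eventually_analyticAt)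
  have hd : DifferentiableOn ℂ (g t) (ball (γ t) r) := fun u hu =>
    (hb u hu).1.differentiableAt.differentiableWithinAt
  have hd' : DifferentiableOn ℂ (g' t) (ball (γ t) r) := fun u hu =>
    (hb u hu).2.differentiableAt.differentiableWithinAt
  filter_upwards [h.local_eq t ht, h'.local_eq t ht, hγ t ht (ball_mem_nhds _ hr)]
    with s hs hs' hsb
  refine ⟨fun e => ?_, fun e => ?_⟩
  · have := eqOn_of_eventuallyEq isOpen_ball (convex_ball _ _) hd hd' (mem_ball_self hr) e
    exact (hs.trans (this.eventuallyEq_of_mem (isOpen_ball.mem_nhds hsb))).trans hs'.symm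
  · have := eqOn_of_eventuallyEq isOpen_ball (convex_ball _ _) hd hd' hsb
      ((hs.symm.trans e).trans hs')
    exact this.eventuallyEq_of_mem (ball_mem_nhds _ hr)

/-- A holomorphic function on an open set continues itself along every path in that set. -/
theorem germCont_const {γ : ℝ → ℂ} {I : Set ℝ} {g : ℂ → ℂ} {U : Set ℂ} (hU : IsOpen U)
    (hg : DifferentiableOn ℂ g U) (h : ∀ t ∈ I, γ t ∈ U) : GermCont γ I fun _ => g :=
  ⟨fun t ht => hg.analyticAt (hU.mem_nhds (h t ht)), fun _ _ => .of_forall fun _ =>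
    EventuallyEq.rfl⟩

/-- Monodromy along radii: the property that the continuations along the radii to all `w` near `w₀`
agree at parameter `s` is propagated over the connected interval `[0, 1]`. -/
theorem radial_eventuallyEq {z : ℂ} {ε : ℝ} {g : ℂ → ℂ} {h : ℂ → ℝ → ℂ → ℂ}
    (hg : ∀ w ∈ ball z ε, GermCont (fun s => z + s * (w - z)) (Icc 0 1) (h w))
    (h0 : ∀ w ∈ ball z ε, h w 0 =ᶠ[𝓝 z] g) {w₀ : ℂ} (hw₀ : w₀ ∈ ball z ε) :
    ∀ᶠ w in 𝓝 w₀, h w 1 =ᶠ[𝓝 w] h w₀ 1 := by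
  have hnear : ∀ᶠ w in 𝓝 w₀, w ∈ ball z ε := isOpen_ball.mem_nhds hw₀
  have key := isPreconnected_Icc.induction₂' (s := Icc (0 : ℝ) 1)
    (fun s s' => (∀ᶠ w in 𝓝 w₀, h w s =ᶠ[𝓝 (z + s * (w - z))] h w₀ s) →
      ∀ᶠ w in 𝓝 w₀, h w s' =ᶠ[𝓝 (z + s' * (w - z))] h w₀ s') ?_
    (fun x y z _ _ _ h1 h2 h3 => h2 (h1 h3)) (left_mem_Icc.2 zero_le_one)
    (right_mem_Icc.2 zero_le_one) ?_
  · simpa using key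
  · intro s hs
    set c := z + s * (w₀ - z) with hc
    obtain ⟨r, hr, hb⟩ := Metric.eventually_nhds_iff_ball.1
      ((hg w₀ hw₀).analytic s hs).eventually_analyticAt
    have hd : DifferentiableOn ℂ (h w₀ s) (ball c r) := fun u hu =>
      (hb u hu).differentiableAt.differentiableWithinAt
    have hη : 0 < r / 2 / (‖w₀ - z‖ + 1) := by positivity
    filter_upwards [(hg w₀ hw₀).local_eq s hs, self_mem_nhdsWithin,
      nhdsWithin_le_nhds (ball_mem_nhds s hη)] with s' e1 hs' hss'
    have hJ : uIcc s s' ⊆ Icc (0 : ℝ) 1 := by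
      rw [← segment_eq_uIcc]; exact (convex_Icc 0 1).segment_subset hs hs'
    have hJ' : ∀ τ ∈ uIcc s s', ‖((τ - s : ℝ) : ℂ) * (w₀ - z)‖ < r / 2 := by
      intro τ hτ
      have h1 : |τ - s| ≤ |s' - s| := abs_sub_left_of_mem_uIcc hτ
      have h2 : |s' - s| < r / 2 / (‖w₀ - z‖ + 1) := by simpa [Real.dist_eq] using hss'
      rw [lt_div_iff₀ (by positivity)] at h2
      rw [norm_mul, Complex.norm_real, Real.norm_eq_abs]
      have h3 : |τ - s| * ‖w₀ - z‖ ≤ |s' - s| * ‖w₀ - z‖ :=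
        mul_le_mul_of_nonneg_right h1 (norm_nonneg _)
      linarith [abs_nonneg (s' - s)]
    -- For `w` close to `w₀`, the piece of the radius between `s` and `s'` stays in a disc where `h
    -- w₀ s` is holomorphic; uniqueness compares it there with `h w`.
    have huniq : ∀ᶠ w in 𝓝 w₀, ∀ a ∈ uIcc s s', ∀ b ∈ uIcc s s',
        h w a =ᶠ[𝓝 (z + a * (w - z))] h w₀ s → h w b =ᶠ[𝓝 (z + b * (w - z))] h w₀ s := by
      filter_upwards [hnear, ball_mem_nhds w₀ (half_pos hr)] with w hw hwr a ha b hb' e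
      refine ((hg w hw).mono hJ).unique (germCont_const isOpen_ball hd fun τ hτ => ?_)
        isPreconnected_uIcc (by fun_prop) ha hb' e
      rw [mem_ball_iff_norm] at hwr ⊢
      have : z + τ * (w - z) - c = τ * (w - w₀) + ((τ - s : ℝ) : ℂ) * (w₀ - z) := by
        rw [hc]; push_cast; ring
      rw [this]
      refine (norm_add_le _ _).trans_lt ?_
      have h4 : ‖(τ : ℂ) * (w - w₀)‖ ≤ ‖w - w₀‖ := by
        rw [norm_mul, Complex.norm_real, Real.norm_of_nonneg (hJ hτ).1]
        exact mul_le_of_le_one_left (norm_nonneg _) (hJ hτ).2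
      linarith [hJ' τ hτ]
    have e2 : ∀ᶠ w in 𝓝 w₀, h w₀ s' =ᶠ[𝓝 (z + s' * (w - z))] h w₀ s := by
      have hcont : ContinuousAt (fun w : ℂ => z + s' * (w - z)) w₀ := by fun_prop
      exact hcont.eventually e1.eventually_nhds
    refine ⟨fun H => ?_, fun H => ?_⟩
    · filter_upwards [H, huniq, e2] with w k1 k2 k3
      exact (k2 s left_mem_uIcc s' right_mem_uIcc k1).trans k3.symm
    · filter_upwards [H, huniq, e2] with w k1 k2 k3
      exact k2 s' right_mem_uIcc s left_mem_uIcc (k1.trans k3)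
  · filter_upwards [hnear] with w hw
    simpa using (h0 w hw).trans (h0 w₀ hw₀).symm

/-- A germ that can be continued along all the radii of a disc extends to the disc. -/
theorem exists_extension_ball {z : ℂ} {ε : ℝ} (hε : 0 < ε) {g : ℂ → ℂ} {h : ℂ → ℝ → ℂ → ℂ}
    (hg : ∀ w ∈ ball z ε, GermCont (fun s => z + s * (w - z)) (Icc 0 1) (h w))
    (h0 : ∀ w ∈ ball z ε, h w 0 =ᶠ[𝓝 z] g) :
    ∃ X : ℂ → ℂ, DifferentiableOn ℂ X (ball z ε) ∧ X =ᶠ[𝓝 z] g ∧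
      ∀ w ∈ ball z ε, h w 1 =ᶠ[𝓝 w] X := by
  have hX : ∀ w ∈ ball z ε, h w 1 =ᶠ[𝓝 w] fun u => h u 1 u := fun w hw =>
    (radial_eventuallyEq hg h0 hw).mono fun u hu => hu.eq_of_nhds.symm
  have h1 : ∀ w ∈ ball z ε, AnalyticAt ℂ (h w 1) w := fun w hw => by
    simpa using (hg w hw).analytic 1 (right_mem_Icc.2 zero_le_one)
  refine ⟨fun u => h u 1 u, fun w hw => ?_, ?_, hX⟩
  · exact ((h1 w hw).congr (hX w hw)).differentiableAt.differentiableWithinAt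
  · have hz : z ∈ ball z ε := mem_ball_self hε
    refine (hX z hz).symm.trans ?_
    have hgz := hg z hz
    have ha := hgz.analytic 0 (left_mem_Icc.2 zero_le_one)
    obtain ⟨r, hr, hb⟩ := Metric.eventually_nhds_iff_ball.1 ha.eventually_analyticAt
    have hc := germCont_const (γ := fun s => z + s * (z - z)) (I := Icc 0 1) isOpen_ball
      (fun u hu => (hb u hu).differentiableAt.differentiableWithinAt) (fun t _ => by simpa using hr)
    have := hgz.unique hc isPreconnected_Icc (by fun_prop) (left_mem_Icc.2 zero_le_one)
      (right_mem_Icc.2 zero_le_one) EventuallyEq.rfl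
    simp only [sub_self, mul_zero, add_zero] at this
    exact this.trans (h0 z hz)

end GermCont

/-! ### Length of Lipschitz paths -/

section Length

variable (γ : LipPath)

theorem LipPath.continuousOn : ContinuousOn γ.toFun (Icc 0 γ.tEnd) := by
  obtain ⟨K, hK⟩ := γ.lipschitz
  exact hK.continuousOn

theorem eVariationOn_Icc_le {f : ℝ → ℂ} {K : ℝ≥0} {a b : ℝ} (hab : a ≤ b)
    (hf : LipschitzOnWith K f (Icc a b)) :
    eVariationOn f (Icc a b) ≤ ENNReal.ofReal (K * (b - a)) := by
  have h1 := hf.comp_eVariationOn_le (mapsTo_id (Icc a b))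
  have h2 := (monotoneOn_id (s := Icc a b)).eVariationOn_eq (left_mem_Icc.2 hab)
    (right_mem_Icc.2 hab)
  rw [inter_self] at h2
  rw [Function.comp_id] at h1
  refine h1.trans ((mul_le_mul_right h2.le _).trans ?_)
  rw [ENNReal.ofReal_mul K.coe_nonneg, ENNReal.ofReal_coe_nnreal]
  rfl

theorem eVariationOn_Icc_add {f : ℝ → ℂ} {a b c : ℝ} (hab : a ≤ b) (hbc : b ≤ c) :
    eVariationOn f (Icc a b) + eVariationOn f (Icc b c) = eVariationOn f (Icc a c) := by
  have := eVariationOn.Icc_add_Icc f (s := univ) hab hbc (mem_univ b)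
  simpa only [univ_inter] using this

variable {γ}

theorem LipPath.eVariationOn_ne_top {s t : ℝ} (hs : 0 ≤ s) (hst : s ≤ t) (ht : t ≤ γ.tEnd) :
    eVariationOn γ.toFun (Icc s t) ≠ ⊤ := by
  obtain ⟨K, hK⟩ := γ.lipschitz
  exact ((eVariationOn_Icc_le hst (hK.mono (Icc_subset_Icc hs ht))).trans_lt
    ENNReal.ofReal_lt_top).ne

theorem LipPath.lengthUpTo_sub {s t : ℝ} (hs : 0 ≤ s) (hst : s ≤ t) (ht : t ≤ γ.tEnd) :
    (γ.lengthUpTo t : ℝ) - γ.lengthUpTo s = (eVariationOn γ.toFun (Icc s t)).toReal := by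
  have h := eVariationOn_Icc_add (f := γ.toFun) hs hst
  rw [LipPath.lengthUpTo, LipPath.lengthUpTo, ENNReal.coe_toNNReal_eq_toReal,
    ENNReal.coe_toNNReal_eq_toReal, ← h, ENNReal.toReal_add
      (LipPath.eVariationOn_ne_top le_rfl hs (hst.trans ht))
      (LipPath.eVariationOn_ne_top hs hst ht), add_sub_cancel_left]

theorem LipPath.norm_sub_le_length {s t : ℝ} (hs : 0 ≤ s) (hst : s ≤ t) (ht : t ≤ γ.tEnd) :
    ‖γ.toFun t - γ.toFun s‖ ≤ γ.lengthUpTo t - γ.lengthUpTo s := by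
  rw [LipPath.lengthUpTo_sub hs hst ht]
  have := eVariationOn.edist_le γ.toFun (right_mem_Icc.2 hst) (left_mem_Icc.2 hst)
  rw [edist_dist, ENNReal.ofReal_le_iff_le_toReal (LipPath.eVariationOn_ne_top hs hst ht),
    dist_eq_norm] at this
  exact this

theorem LipPath.length_sub_le {K : ℝ≥0} (hK : LipschitzOnWith K γ.toFun (Icc 0 γ.tEnd)) {s t : ℝ}
    (hs : 0 ≤ s) (hst : s ≤ t) (ht : t ≤ γ.tEnd) :
    (γ.lengthUpTo t : ℝ) - γ.lengthUpTo s ≤ K * (t - s) := by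
  rw [LipPath.lengthUpTo_sub hs hst ht]
  refine ENNReal.toReal_le_of_le_ofReal (mul_nonneg K.coe_nonneg (by linarith)) ?_
  exact eVariationOn_Icc_le hst (hK.mono (Icc_subset_Icc hs ht))

theorem LipPath.lengthUpTo_zero : γ.lengthUpTo 0 = 0 := by
  rw [LipPath.lengthUpTo, eVariationOn.subsingleton _ (by simp)]
  rfl

theorem LipPath.lengthUpTo_mono {s t : ℝ} (hs : 0 ≤ s) (hst : s ≤ t) (ht : t ≤ γ.tEnd) :
    (γ.lengthUpTo s : ℝ) ≤ γ.lengthUpTo t := by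
  have := (norm_nonneg _).trans (LipPath.norm_sub_le_length (γ := γ) hs hst ht)
  linarith

theorem LipPath.continuousOn_lengthUpTo : ContinuousOn γ.lengthUpTo (Icc 0 γ.tEnd) := by
  obtain ⟨K, hK⟩ := γ.lipschitz
  refine (LipschitzOnWith.of_dist_le_mul (K := K) fun s hs t ht => ?_).continuousOn
  rw [NNReal.dist_eq, Real.dist_eq]
  rcases le_total s t with h | h
  · rw [abs_sub_comm, abs_sub_comm s, abs_of_nonneg (sub_nonneg.2 h),
      abs_of_nonneg (sub_nonneg.2 (LipPath.lengthUpTo_mono hs.1 h ht.2))]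
    exact LipPath.length_sub_le hK hs.1 h ht.2
  · rw [abs_of_nonneg (sub_nonneg.2 h),
      abs_of_nonneg (sub_nonneg.2 (LipPath.lengthUpTo_mono ht.1 h hs.2))]
    exact LipPath.length_sub_le hK ht.1 h hs.2

end Length

/-! ### Margins and the allowed open set -/

section Graph

/-- The graph of a discrete filtered set, as a subset of `ℝ × ℂ`. -/
def DFS.realGraph (Ω : DFS) : Set (ℝ × ℂ) := {p | ∃ L : ℝ≥0, (L : ℝ) = p.1 ∧ p.2 ∈ Ω.carrier L}

theorem DFS.mem_allowed_of_margin {Ω : DFS} {ε : ℝ} (hε : 0 < ε) {l : ℝ≥0} {z : ℂ}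
    (h : Margin Ω.realGraph ε (l, z)) : (l, z) ∈ Ω.allowed := by
  intro hc
  obtain ⟨s, hs, hd⟩ := Metric.mem_closure_iff.1 hc ε hε
  have := h ((s.1 : ℝ), s.2) ⟨s.1, rfl, hs⟩
  exact absurd hd (not_lt.2 this)

/-- A singular point at length `a` persists at every greater length, so translating it by `l - l'`
gives another point of the graph. This is why an upper bound for the length is as good as the length
itself. -/
theorem DFS.margin_of_le {Ω : DFS} {ε l l' : ℝ} {z : ℂ} (h : Margin Ω.realGraph ε (l, z))
    (hl : l' ≤ l) : Margin Ω.realGraph ε (l', z) := by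
  rintro ⟨a, ω⟩ ⟨L, hL, hω⟩
  have := h (a + (l - l'), ω) ⟨L + (l - l').toNNReal, ?_, Ω.mono' _ _ le_self_add hω⟩
  · rw [Prod.dist_eq] at this ⊢
    simp only [Real.dist_eq] at this ⊢
    rwa [show l - (a + (l - l')) = l' - a by ring] at this
  · simp only at hL ⊢
    rw [NNReal.coe_add, Real.coe_toNNReal _ (by linarith), hL]

/-- The lifted path is a compact set disjoint from the closure of the graph. -/
theorem LipPath.IsAllowed.exists_margin {γ : LipPath} {Ω : DFS} (h : γ.IsAllowed Ω) :
    ∃ ε > 0, ∀ t ∈ Icc 0 γ.tEnd, Margin Ω.realGraph ε (γ.lengthUpTo t, γ.toFun t) := by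
  have hK : IsCompact ((fun t => (γ.lengthUpTo t, γ.toFun t)) '' Icc 0 γ.tEnd) :=
    isCompact_Icc.image_of_continuousOn (LipPath.continuousOn_lengthUpTo.prodMk γ.continuousOn)
  have hd : Disjoint ((fun t => (γ.lengthUpTo t, γ.toFun t)) '' Icc 0 γ.tEnd)
      (closure Ω.graph) := by
    rw [disjoint_left]
    rintro _ ⟨t, ht, rfl⟩ hc
    exact h t ht hc
  obtain ⟨ε, hε, hdis⟩ := hd.exists_thickenings hK isClosed_closure
  refine ⟨ε, hε, ?_⟩
  rintro t ht ⟨a, ω⟩ ⟨L, hL, hω⟩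
  by_contra hlt
  push Not at hlt
  simp only at hL hω
  subst hL
  refine disjoint_left.1 hdis
    (self_subset_thickening hε _ (mem_image_of_mem _ ht)) ?_
  exact mem_thickening_iff.2 ⟨(L, ω), subset_closure hω, hlt⟩

end Graph

/-! ### Prolonging a path by a segment -/

section Extend

/-- The path `γ` followed by the segment from its end point to `w`. -/
def LipPath.extend (γ : LipPath) (w : ℂ) : LipPath where
  toFun t := γ.toFun (min t γ.tEnd) + ((max (t - γ.tEnd) 0 : ℝ) : ℂ) * (w - γ.toFun γ.tEnd)
  tEnd := γ.tEnd + 1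
  tEnd_nonneg := by linarith [γ.tEnd_nonneg]
  lipschitz := by
    obtain ⟨K, hK⟩ := γ.lipschitz
    have h1 : LipschitzOnWith (K * 1) (fun t => γ.toFun (min t γ.tEnd))
        (Icc 0 (γ.tEnd + 1)) :=
      hK.comp (LipschitzWith.id.min_const γ.tEnd).lipschitzOnWith
        fun t ht => ⟨le_min ht.1 γ.tEnd_nonneg, min_le_right _ _⟩
    have h2 : LipschitzWith (‖w - γ.toFun γ.tEnd‖₊)
        (fun t : ℝ => ((max (t - γ.tEnd) 0 : ℝ) : ℂ) * (w - γ.toFun γ.tEnd)) := by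
      refine LipschitzWith.of_dist_le_mul fun s t => ?_
      rw [dist_eq_norm, ← sub_mul, ← Complex.ofReal_sub, norm_mul, Complex.norm_real, mul_comm,
        coe_nnnorm]
      refine mul_le_mul_of_nonneg_left ?_ (norm_nonneg _)
      rw [Real.norm_eq_abs, Real.dist_eq]
      refine (abs_max_sub_max_le_abs _ _ _).trans_eq ?_
      rw [sub_sub_sub_cancel_right]
    exact ⟨_, h1.add h2.lipschitzOnWith⟩
  map_zero := by
    rw [min_eq_left γ.tEnd_nonneg, γ.map_zero, max_eq_right (by linarith [γ.tEnd_nonneg])]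
    simp

variable {γ : LipPath} {w : ℂ}

theorem LipPath.extend_of_le {t : ℝ} (ht : t ≤ γ.tEnd) : (γ.extend w).toFun t = γ.toFun t := by
  simp [LipPath.extend, min_eq_left ht, max_eq_right (sub_nonpos.2 ht)]

theorem LipPath.extend_of_ge {t : ℝ} (ht : γ.tEnd ≤ t) : (γ.extend w).toFun t =
    γ.toFun γ.tEnd + ((t - γ.tEnd : ℝ) : ℂ) * (w - γ.toFun γ.tEnd) := by
  simp only [LipPath.extend, min_eq_right ht, max_eq_left (sub_nonneg.2 ht)]

theorem LipPath.extend_end : (γ.extend w).toFun (γ.extend w).tEnd = w := by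
  rw [LipPath.extend_of_ge (by simp [LipPath.extend])]
  simp [LipPath.extend]

theorem LipPath.lengthUpTo_extend_of_le {t : ℝ} (ht : t ≤ γ.tEnd) :
    (γ.extend w).lengthUpTo t = γ.lengthUpTo t := by
  rw [LipPath.lengthUpTo, LipPath.lengthUpTo]
  congr 1
  exact eVariationOn.congr fun s hs => LipPath.extend_of_le (hs.2.trans ht)

theorem LipPath.lengthUpTo_extend_of_ge {t : ℝ} (ht : γ.tEnd ≤ t) (ht' : t ≤ γ.tEnd + 1) :
    ((γ.extend w).lengthUpTo t : ℝ) ≤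
      γ.lengthUpTo γ.tEnd + (t - γ.tEnd) * ‖w - γ.toFun γ.tEnd‖ := by
  have h := LipPath.lengthUpTo_sub (γ := γ.extend w) γ.tEnd_nonneg ht ht'
  rw [LipPath.lengthUpTo_extend_of_le le_rfl, sub_eq_iff_eq_add'] at h
  rw [h]
  gcongr
  rw [mul_comm]
  refine ENNReal.toReal_le_of_le_ofReal (mul_nonneg (norm_nonneg _) (by linarith)) ?_
  refine eVariationOn_Icc_le (K := ‖w - γ.toFun γ.tEnd‖₊) ht
    (LipschitzOnWith.of_dist_le_mul fun s hs s' hs' => ?_)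
  rw [LipPath.extend_of_ge hs.1, LipPath.extend_of_ge hs'.1, dist_add_left, dist_eq_norm, ← sub_mul,
    ← Complex.ofReal_sub, norm_mul, Complex.norm_real, mul_comm, coe_nnnorm, sub_sub_sub_cancel_right,
    Real.dist_eq, Real.norm_eq_abs]

/-- Along a segment of length `d < ε`, both coordinates of `(length, point)` change by at most `d`,
leaving the positive margin `ε - d` in the sup distance. -/
theorem LipPath.IsAllowed.extend {Ω : DFS} (h : γ.IsAllowed Ω) {ε l : ℝ}
    (hl : (γ.lengthUpTo γ.tEnd : ℝ) ≤ l) (hm : Margin Ω.realGraph ε (l, γ.toFun γ.tEnd))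
    (hw : w ∈ ball (γ.toFun γ.tEnd) ε) : (γ.extend w).IsAllowed Ω := by
  intro t ht
  rw [mem_ball_iff_norm] at hw
  rcases le_total t γ.tEnd with h1 | h1
  · rw [LipPath.lengthUpTo_extend_of_le h1, LipPath.extend_of_le h1]
    exact h t ⟨ht.1, h1⟩
  · have h2 : t - γ.tEnd ≤ 1 := by
      have : t ≤ γ.tEnd + 1 := ht.2
      linarith
    refine DFS.mem_allowed_of_margin (sub_pos.2 hw) ?_
    refine DFS.margin_of_le (l := l + (t - γ.tEnd) * ‖w - γ.toFun γ.tEnd‖) ?_ ?_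
    · refine hm.of_norm_sub_le (b := ‖w - γ.toFun γ.tEnd‖) ?_ (by linarith)
      have h3 : (t - γ.tEnd) * ‖w - γ.toFun γ.tEnd‖ ≤ ‖w - γ.toFun γ.tEnd‖ :=
        mul_le_of_le_one_left (norm_nonneg _) h2
      rw [LipPath.extend_of_ge h1, Prod.norm_def]
      simp only [Prod.fst_sub, Prod.snd_sub, add_sub_cancel_left, norm_mul, Complex.norm_real,
        Real.norm_eq_abs, abs_of_nonneg (sub_nonneg.2 h1), abs_norm, max_self]
      exact h3
    · exact (LipPath.lengthUpTo_extend_of_ge h1 ht.2).trans (by linarith)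

end Extend

/-! ### Passing between Lipschitz paths and chains -/

section Reach

/-- The germ of `f` at `0` continues to the germ of `g` at `z` along some `Ω`-allowed path of
length at most `l`. -/
def Reach (Ω : DFS) (f : ℂ → ℂ) (z : ℂ) (l : ℝ) (g : ℂ → ℂ) : Prop :=
  ∃ γ : LipPath, γ.IsAllowed Ω ∧ γ.toFun γ.tEnd = z ∧ (γ.lengthUpTo γ.tEnd : ℝ) ≤ l ∧
    ∃ G, GermCont γ.toFun (Icc 0 γ.tEnd) G ∧ G 0 =ᶠ[𝓝 0] f ∧ G γ.tEnd =ᶠ[𝓝 z] g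

variable {Ω : DFS} {f : ℂ → ℂ}

/-- Append every radius of the disc to the path. The continuations along these allowed paths glue to
one holomorphic function by `exists_extension_ball`, and each prolonged path witnesses `Reach` at
its new end point. -/
theorem Reach.exists_disc (hf : ∀ γ : LipPath, γ.IsAllowed Ω → ContinuableAlong f γ) {z : ℂ}
    {l ε : ℝ} {g : ℂ → ℂ} (h : Reach Ω f z l g) (hε : 0 < ε)
    (hm : Margin Ω.realGraph ε (l, z)) :
    ∃ X : ℂ → ℂ, DifferentiableOn ℂ X (ball z ε) ∧ X =ᶠ[𝓝 z] g ∧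
      ∀ w ∈ ball z ε, Reach Ω f w (l + ‖w - z‖) X := by
  obtain ⟨γ, hγ, rfl, hl, G, hG, hG0, hGg⟩ := h
  have hall : ∀ w ∈ ball (γ.toFun γ.tEnd) ε, (γ.extend w).IsAllowed Ω := fun w hw =>
    hγ.extend hl hm hw
  have hcont : ∀ w, ∃ H : ℝ → ℂ → ℂ, w ∈ ball (γ.toFun γ.tEnd) ε →
      GermCont (γ.extend w).toFun (Icc 0 (γ.tEnd + 1)) H ∧ H 0 =ᶠ[𝓝 0] f := by
    intro w
    by_cases hw : w ∈ ball (γ.toFun γ.tEnd) ε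
    · obtain ⟨H, h1, h2, h3⟩ := hf _ (hall w hw)
      exact ⟨H, fun _ => ⟨⟨h1, h3⟩, h2⟩⟩
    · exact ⟨fun _ => f, fun h => absurd h hw⟩
  choose H hH using hcont
  have hT := γ.tEnd_nonneg
  have hseg : ∀ w ∈ ball (γ.toFun γ.tEnd) ε,
      GermCont (fun s => γ.toFun γ.tEnd + s * (w - γ.toFun γ.tEnd)) (Icc 0 1)
        (fun s => H w (γ.tEnd + s)) := by
    intro w hw
    have hmaps : MapsTo (fun s : ℝ => γ.tEnd + s) (Icc 0 1) (Icc 0 (γ.tEnd + 1)) := fun s hs =>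
      ⟨by linarith [hs.1], by linarith [hs.2]⟩
    have hval : ∀ s ∈ Icc (0 : ℝ) 1, (γ.extend w).toFun (γ.tEnd + s) =
        γ.toFun γ.tEnd + s * (w - γ.toFun γ.tEnd) := fun s hs => by
      rw [LipPath.extend_of_ge (by linarith [hs.1])]; simp
    refine ⟨fun s hs => ?_, fun s hs => ?_⟩
    · rw [← hval s hs]
      exact (hH w hw).1.analytic _ (hmaps hs)
    · have h1 := (hH w hw).1.local_eq _ (hmaps hs)
      have h2 : Tendsto (fun s : ℝ => γ.tEnd + s) (𝓝[Icc 0 1] s)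
          (𝓝[Icc 0 (γ.tEnd + 1)] (γ.tEnd + s)) :=
        (by fun_prop : Continuous fun s : ℝ => γ.tEnd + s).continuousWithinAt.tendsto_nhdsWithin
          hmaps
      filter_upwards [h2.eventually h1, self_mem_nhdsWithin] with u hu hu'
      rwa [hval u hu'] at hu
  have hstart : ∀ w ∈ ball (γ.toFun γ.tEnd) ε,
      H w (γ.tEnd + 0) =ᶠ[𝓝 (γ.toFun γ.tEnd)] g := by
    intro w hw
    rw [add_zero]
    have h1 : GermCont γ.toFun (Icc 0 γ.tEnd) (H w) :=
      ((hH w hw).1.mono (Icc_subset_Icc le_rfl (by linarith))).congr fun t ht =>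
        LipPath.extend_of_le ht.2
    refine (h1.unique hG isPreconnected_Icc γ.continuousOn (left_mem_Icc.2 hT)
      (right_mem_Icc.2 hT) ?_).trans hGg
    rw [γ.map_zero]
    exact (hH w hw).2.trans hG0.symm
  obtain ⟨X, hXd, hXg, hX⟩ := exists_extension_ball hε hseg hstart
  refine ⟨X, hXd, hXg, fun w hw => ⟨γ.extend w, hall w hw, LipPath.extend_end, ?_, H w,
    (hH w hw).1, (hH w hw).2, hX w hw⟩⟩
  refine (LipPath.lengthUpTo_extend_of_ge (t := γ.tEnd + 1) (by linarith) le_rfl).trans ?_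
  rw [add_sub_cancel_left, one_mul]
  linarith

theorem reach_zero (hf : AnalyticAt ℂ f 0) {ε : ℝ} (hε : 0 < ε)
    (hm : Margin Ω.realGraph ε 0) : Reach Ω f 0 0 f := by
  let γ : LipPath := ⟨fun _ => 0, 0, le_rfl, ⟨0, LipschitzWith.const 0 |>.lipschitzOnWith⟩, rfl⟩
  refine ⟨γ, fun t ht => ?_, rfl, by simp [LipPath.lengthUpTo_zero, γ], fun _ => f, ?_,
    EventuallyEq.rfl, EventuallyEq.rfl⟩
  · have : t = 0 := by simpa [γ] using ht
    rw [this, LipPath.lengthUpTo_zero]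
    exact DFS.mem_allowed_of_margin hε hm
  · exact ⟨fun t _ => hf, fun t _ => .of_forall fun s => EventuallyEq.rfl⟩

theorem exists_seq_of_step {α : Type*} (P : ℕ → α → Prop) (R : ℕ → α → α → Prop)
    (h0 : ∃ a, P 0 a) (hs : ∀ n a, P n a → ∃ b, P (n + 1) b ∧ R n a b) :
    ∃ u : ℕ → α, (∀ n, P n (u n)) ∧ ∀ n, R n (u n) (u (n + 1)) := by
  choose! b hb hR using hs
  obtain ⟨a, ha⟩ := h0
  let u : ℕ → α := fun n => Nat.rec a (fun n x => b n x) n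
  have hu : ∀ n, P n (u n) := by
    intro n
    induction n with
    | zero => exact ha
    | succ n ih => exact hb n _ ih
  exact ⟨u, hu, fun n => hR n _ (hu n)⟩

/-- Continuability along Lipschitz paths implies continuability along chains. -/
theorem chainCont_of_continuable (hf0 : AnalyticAt ℂ f 0)
    (hf : ∀ γ : LipPath, γ.IsAllowed Ω → ContinuableAlong f γ) (Λ : ℝ) :
    ChainCont Ω.realGraph f Λ := by
  intro ε hε
  refine ⟨ε, hε, fun p hp hs hm _ => ?_⟩
  have key := exists_seq_of_step
    (fun j X => DifferentiableOn ℂ X (ball (p j).2 ε) ∧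
      (∀ w ∈ ball (p j).2 ε, Reach Ω f w ((p j).1 + ‖w - (p j).2‖) X) ∧
        (j = 0 → X =ᶠ[𝓝 0] f))
    (fun j X Y => Y =ᶠ[𝓝 (p (j + 1)).2] X) ?_ ?_
  · obtain ⟨X, hX, hXs⟩ := key
    exact ⟨X, fun j => (hX j).1, (hX 0).2.2 rfl, hXs⟩
  · have hm0 := hm 0
    rw [hp.zero] at hm0 ⊢
    obtain ⟨X, h1, h2, h3⟩ := (reach_zero hf0 hε hm0).exists_disc hf hε hm0
    exact ⟨X, h1, h3, fun _ => h2⟩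
  · rintro j X ⟨-, hr, -⟩
    have hstep := hp.step j
    have h1 := hr (p (j + 1)).2 (mem_ball_iff_norm.2 (hstep.trans_lt (hs j)))
    obtain ⟨Y, hY1, hY2, hY3⟩ := h1.exists_disc hf hε
      (DFS.margin_of_le (hm (j + 1)) (by linarith))
    refine ⟨Y, ⟨hY1, fun w hw => ?_, by simp⟩, hY2⟩
    obtain ⟨γ, a1, a2, a3, a4⟩ := hY3 w hw
    exact ⟨γ, a1, a2, a3.trans (by linarith), a4⟩

/-- Continuability along chains implies continuability along Lipschitz paths. -/
theorem continuableAlong_of_chainCont (hf : ∀ Λ, ChainCont Ω.realGraph f Λ) {γ : LipPath}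
    (hγ : γ.IsAllowed Ω) : ContinuableAlong f γ := by
  obtain ⟨ε, hε, hm⟩ := hγ.exists_margin
  obtain ⟨κ, hκ, H⟩ := hf (γ.lengthUpTo γ.tEnd) ε hε
  obtain ⟨K, hK⟩ := γ.lipschitz
  -- Time step over which a `K`-Lipschitz path has length less than `κ`; the `+ 1` covers `K = 0`.
  set h := κ / (K + 1) with hh
  have hK1 : (0 : ℝ) < K + 1 := by positivity
  have hh0 : 0 < h := by positivity
  have hKh : K * h < κ := by
    have : (K + 1) * h = κ := by rw [hh]; field_simp
    nlinarith
  have hT := γ.tEnd_nonneg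
  let t : ℕ → ℝ := fun j => min (j * h) γ.tEnd
  have ht0 : ∀ j, 0 ≤ t j := fun j => le_min (by positivity) hT
  have htT : ∀ j, t j ≤ γ.tEnd := fun j => min_le_right _ _
  have hts : ∀ j, t j ≤ t (j + 1) := fun j =>
    min_le_min_right _ (mul_le_mul_of_nonneg_right (by simp) hh0.le)
  have hts' : ∀ j, t (j + 1) - t j ≤ h := by
    intro j
    simp only [t, Nat.cast_add, Nat.cast_one, add_mul, one_mul]
    rcases le_total (j * h) γ.tEnd with h1 | h1
    · rw [min_eq_left h1]
      linarith [min_le_left (j * h + h) γ.tEnd]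
    · rw [min_eq_right h1]
      linarith [min_le_right (j * h + h) γ.tEnd]
  have hstep : ∀ j, (γ.lengthUpTo (t (j + 1)) : ℝ) - γ.lengthUpTo (t j) < κ := fun j =>
    ((LipPath.length_sub_le hK (ht0 j) (hts j) (htT _)).trans
      (mul_le_mul_of_nonneg_left (hts' j) K.coe_nonneg)).trans_lt hKh
  obtain ⟨X, hX⟩ := H (fun j => (γ.lengthUpTo (t j), γ.toFun (t j)))
    ⟨by simp [t, min_eq_left hT, LipPath.lengthUpTo_zero, γ.map_zero],
      fun j => LipPath.norm_sub_le_length (ht0 j) (hts j) (htT _)⟩ hstep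
    (fun j => hm _ ⟨ht0 j, htT j⟩)
    (fun j => LipPath.lengthUpTo_mono (ht0 j) (htT j) le_rfl)
  have hdist : ∀ (j : ℕ) (s : ℝ), s ∈ Icc 0 γ.tEnd → (j : ℝ) * h ≤ γ.tEnd → |s - j * h| ≤ h →
      γ.toFun s ∈ ball (γ.toFun (t j)) κ := by
    intro j s hs hj hsj
    have e : t j = j * h := min_eq_left hj
    have h1 := hK.dist_le_mul s hs (t j) ⟨ht0 j, htT j⟩
    rw [e, Real.dist_eq] at h1
    rw [mem_ball, e]
    exact (h1.trans (mul_le_mul_of_nonneg_left hsj K.coe_nonneg)).trans_lt hKh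
  have hfl : ∀ s ∈ Icc 0 γ.tEnd, (⌊s / h⌋₊ : ℝ) * h ≤ s ∧ s < (⌊s / h⌋₊ + 1) * h := fun s hs =>
    ⟨(le_div_iff₀ hh0).1 (Nat.floor_le (div_nonneg hs.1 hh0.le)),
      (div_lt_iff₀ hh0).1 (Nat.lt_floor_add_one _)⟩
  refine ⟨fun s => X ⌊s / h⌋₊, fun s hs => ?_, by simpa using hX.start, fun s hs => ?_⟩
  · obtain ⟨h1, h2⟩ := hfl s hs
    refine (hX.diff ⌊s / h⌋₊).analyticAt (isOpen_ball.mem_nhds ?_)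
    exact hdist _ s hs (h1.trans hs.2) (by rw [abs_of_nonneg (by linarith)]; linarith)
  · obtain ⟨h1, h2⟩ := hfl s hs
    set j := ⌊s / h⌋₊ with hj
    have hlow : ((j : ℝ) - 1) * h < s := by linarith
    filter_upwards [self_mem_nhdsWithin, nhdsWithin_le_nhds (isOpen_Ioo.mem_nhds ⟨hlow, h2⟩)]
      with u hu hu'
    obtain ⟨h3, h4⟩ := hfl u hu
    set k := ⌊u / h⌋₊ with hk
    have hk1 : k < j + 1 := by
      have : (k : ℝ) < j + 1 := lt_of_mul_lt_mul_right (h3.trans_lt hu'.2) hh0.le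
      exact_mod_cast this
    have hk2 : j < k + 2 := by
      have : (j : ℝ) - 1 < k + 1 := lt_of_mul_lt_mul_right (hu'.1.trans h4) hh0.le
      have : (j : ℝ) < k + 2 := by linarith
      exact_mod_cast this
    -- Close to `s` the sampling index can only stay the same or, when `s` is at or above a sampling
    -- time and `u` is below it, drop by one.
    rcases (by omega : k = j ∨ j = k + 1) with e | e
    · rw [e]
    · have hjT : ((k + 1 : ℕ) : ℝ) * h ≤ γ.tEnd := by rw [← e]; exact h1.trans hs.2
      have m1 := hdist k u hu (h3.trans hu.2) (by rw [abs_of_nonneg (by linarith)]; linarith)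
      have m2 : γ.toFun u ∈ ball (γ.toFun (t (k + 1))) κ := by
        refine hdist (k + 1) u hu hjT ?_
        push_cast
        rw [abs_of_nonpos (by linarith)]
        linarith
      rw [← hj, e]
      have := hX.eqOn_succ k ((LipPath.norm_sub_le_length (ht0 k) (hts k) (htT _)).trans_lt
        (hstep k))
      exact (this.eventuallyEq_of_mem
        ((isOpen_ball.inter isOpen_ball).mem_nhds ⟨m2, m1⟩)).symm

end Reach

/-! ### Graphs of sums and of iterated sums -/

section DFSGraph

theorem DFS.realGraph_mono {Ω Ω' : DFS} (h : ∀ L, Ω.carrier L ⊆ Ω'.carrier L) :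
    Ω.realGraph ⊆ Ω'.realGraph := by
  rintro p ⟨L, hL, hp⟩
  exact ⟨L, hL, h L hp⟩

theorem DFS.realGraph_subset_prod {r : ℕ} (Ω : Fin r → DFS) (i : Fin r) :
    (Ω i).realGraph ⊆ (∏ i, Ω i).realGraph := by
  refine DFS.realGraph_mono fun L ω hω => ?_
  rw [← Finset.mul_prod_erase _ _ (Finset.mem_univ i), DFS.mem_mul]
  exact Or.inr (Or.inl hω)

theorem DFS.realGraph_subset_iterSum (Ω : DFS) : Ω.realGraph ⊆ Ω.iterSum.realGraph := by
  refine DFS.realGraph_mono fun L ω hω => mem_iUnion.2 ⟨0, ?_⟩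
  rwa [zero_add, pow_one]

theorem DFS.add_mem_realGraph_iterSum (Ω : DFS) {s t : ℝ × ℂ} (hs : s ∈ Ω.realGraph)
    (ht : t ∈ Ω.iterSum.realGraph) : s + t ∈ Ω.iterSum.realGraph := by
  obtain ⟨L, hL, hs⟩ := hs
  obtain ⟨L', hL', ht⟩ := ht
  obtain ⟨n, ht⟩ := mem_iUnion.1 ht
  refine ⟨L + L', by simp [hL, hL'], mem_iUnion.2 ⟨n + 1, ?_⟩⟩
  rw [pow_succ', DFS.mem_mul]
  exact Or.inl ⟨L, L', rfl, s.2, hs, t.2, ht, rfl⟩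

theorem DFS.exists_le_realGraph (Ω : DFS) : ∃ δ : ℝ, 0 < δ ∧ ∀ s ∈ Ω.realGraph, δ ≤ s.1 := by
  obtain ⟨δ, hδ, he⟩ := Ω.empty'
  refine ⟨δ, hδ, ?_⟩
  rintro s ⟨L, hL, hs⟩
  rw [← hL]
  by_contra hlt
  have := Ω.mono' L δ (by exact_mod_cast (not_le.1 hlt).le) hs
  rwa [he] at this

end DFSGraph

/-! ### Linear operations preserve continuability along chains -/

section ChainContOps

variable {E F : Type*} [NormedAddCommGroup E] [NormedSpace ℂ E] [NormedAddCommGroup F]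
  [NormedSpace ℂ F] {S : Set (ℝ × ℂ)} {Λ : ℝ}

theorem ChainCont.map {f : ℂ → E} (h : ChainCont S f Λ) (T : E →L[ℂ] F) :
    ChainCont S (fun z => T (f z)) Λ := by
  intro ε hε
  obtain ⟨κ, hκ, H⟩ := h ε hε
  refine ⟨κ, hκ, fun p hp hs hm hl => ?_⟩
  obtain ⟨X, hX⟩ := H p hp hs hm hl
  exact ⟨fun j z => T (X j z), fun j => T.differentiable.comp_differentiableOn (hX.diff j),
    hX.start.fun_comp T, fun j => (hX.step j).fun_comp T⟩

theorem ChainCont.add {f g : ℂ → E} (hf : ChainCont S f Λ) (hg : ChainCont S g Λ) :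
    ChainCont S (fun z => f z + g z) Λ := by
  intro ε hε
  obtain ⟨κ, hκ, H⟩ := hf ε hε
  obtain ⟨κ', hκ', H'⟩ := hg ε hε
  refine ⟨min κ κ', lt_min hκ hκ', fun p hp hs hm hl => ?_⟩
  obtain ⟨X, hX⟩ := H p hp (fun j => (hs j).trans_le (min_le_left _ _)) hm hl
  obtain ⟨Y, hY⟩ := H' p hp (fun j => (hs j).trans_le (min_le_right _ _)) hm hl
  have hX := hX.mono (min_le_left κ κ')
  have hY := hY.mono (min_le_right κ κ')
  exact ⟨fun j z => X j z + Y j z, fun j => (hX.diff j).add (hY.diff j), hX.start.add hY.start,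
    fun j => (hX.step j).add (hY.step j)⟩

theorem ChainCont.zero : ChainCont S (fun _ => (0 : E)) Λ := fun _ _ =>
  ⟨1, one_pos, fun _ _ _ _ _ => ⟨fun _ _ => 0, fun _ => differentiableOn_const _,
    EventuallyEq.rfl, fun _ => EventuallyEq.rfl⟩⟩

theorem ChainCont.sum {ι : Type*} (s : Finset ι) {f : ι → ℂ → E}
    (h : ∀ i, ChainCont S (f i) Λ) : ChainCont S (fun z => ∑ i ∈ s, f i z) Λ := by
  classical
  induction s using Finset.induction_on with
  | empty => simpa using ChainCont.zero
  | insert i s hi ih =>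
    simp only [Finset.sum_insert hi]
    exact (h i).add ih

end ChainContOps

/-! ### Taylor coefficients of a convolution -/

section Taylor

/-- By induction on `n` from `(X * V)' = X V(0) + X * V'`. Through the Borel transform this matches
the product of formal series without constant term. -/
theorem iteratedDeriv_conv {X V : ℂ → ℂ} (hX : AnalyticAt ℂ X 0) (hV : AnalyticAt ℂ V 0) (n : ℕ) :
    iteratedDeriv n (conv 0 X V) 0 =
      ∑ k ∈ Finset.range n, iteratedDeriv (n - 1 - k) X 0 * iteratedDeriv k V 0 := by
  induction n generalizing V with
  | zero => simp [conv_self]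
  | succ n ih =>
    obtain ⟨R, hR, hb⟩ := Metric.eventually_nhds_iff_ball.1
      (hX.eventually_analyticAt.and hV.eventually_analyticAt)
    have hXd : DifferentiableOn ℂ X (ball 0 R) := fun u hu =>
      (hb u hu).1.differentiableAt.differentiableWithinAt
    have hVd : DifferentiableOn ℂ V (ball 0 R) := fun u hu =>
      (hb u hu).2.differentiableAt.differentiableWithinAt
    have hder : deriv (conv 0 X V) =ᶠ[𝓝 0] fun z => X z * V 0 + conv 0 X (deriv V) z := by
      filter_upwards [ball_mem_nhds 0 hR] with z hz using (hasDerivAt_conv hXd hVd hz).deriv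
    have hc : AnalyticAt ℂ (conv 0 X (deriv V)) 0 :=
      (differentiableOn_conv hXd (hVd.deriv isOpen_ball)).analyticAt (ball_mem_nhds 0 hR)
    rw [iteratedDeriv_succ', hder.iteratedDeriv_eq,
      iteratedDeriv_fun_add (hX.contDiffAt.mul contDiffAt_const) hc.contDiffAt, ih hV.deriv,
      iteratedDeriv_mul_const_field, Finset.sum_range_succ']
    simp only [iteratedDeriv_zero, iteratedDeriv_succ', Nat.add_sub_cancel, Nat.sub_zero]
    rw [add_comm]
    congr 1
    refine Finset.sum_congr rfl fun k _ => ?_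
    rw [show n - 1 - k = n - (k + 1) by omega]

theorem iteratedDeriv_of_hasFPowerSeriesAt {f : ℂ → ℂ} {c : ℕ → ℂ}
    (h : HasFPowerSeriesAt f (FormalMultilinearSeries.ofScalars ℂ c) 0) (n : ℕ) :
    iteratedDeriv n f 0 = n.factorial * c n := by
  have h1 := h.analyticAt.hasFPowerSeriesAt.eq_formalMultilinearSeries h
  have h2 := congrArg (fun p => FormalMultilinearSeries.coeff p n) h1
  simp only [FormalMultilinearSeries.coeff_ofScalars] at h2
  rw [← h2, mul_div_cancel₀]
  exact_mod_cast n.factorial_ne_zero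

end Taylor

/-! ### Bounded coefficient families and the shift operators -/

section Coefficients

variable {r : ℕ}

/-- The bounded families indexed by the monomials in `r` variables. -/
abbrev CoeffSpace (r : ℕ) : Type := lp (fun _ : Fin r →₀ ℕ => ℂ) ⊤

/-- The evaluation of a bounded family at the monomial `1`. -/
def evalZero (r : ℕ) : CoeffSpace r →L[ℂ] ℂ :=
  LinearMap.mkContinuous
    { toFun := fun b => b 0
      map_add' := fun _ _ => rfl
      map_smul' := fun _ _ => rfl } 1 fun b => by
    rw [one_mul]
    exact lp.norm_apply_le_norm ENNReal.top_ne_zero b 0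

theorem evalZero_apply (b : CoeffSpace r) : evalZero r b = b 0 := rfl

open Classical in
/-- The coefficients of the quotient by the `i`-th variable of the part of the series that involves
the `i`-th variable but not the previous ones. -/
def shiftFun (ρ : ℝ) (i : Fin r) (b : (Fin r →₀ ℕ) → ℂ) (m : Fin r →₀ ℕ) : ℂ :=
  if ∀ j < i, m j = 0 then (ρ : ℂ)⁻¹ * b (m + Finsupp.single i 1) else 0

theorem norm_shiftFun_le (ρ : ℝ) (i : Fin r) (b : CoeffSpace r) (m : Fin r →₀ ℕ) :
    ‖shiftFun ρ i b m‖ ≤ |ρ|⁻¹ * ‖b‖ := by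
  rw [shiftFun]
  split_ifs
  · rw [norm_mul, norm_inv, Complex.norm_real, Real.norm_eq_abs]
    gcongr
    exact lp.norm_apply_le_norm ENNReal.top_ne_zero b _
  · rw [norm_zero]
    positivity

/-- The bounded operator on coefficients given by `shiftFun`. -/
def shift (ρ : ℝ) (i : Fin r) : CoeffSpace r →L[ℂ] CoeffSpace r :=
  LinearMap.mkContinuous
    { toFun := fun b => ⟨shiftFun ρ i b, memℓp_infty ⟨|ρ|⁻¹ * ‖b‖, by
        rintro _ ⟨m, rfl⟩
        exact norm_shiftFun_le ρ i b m⟩⟩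
      map_add' := fun a b => by
        ext m
        simp only [lp.coeFn_add, Pi.add_apply, shiftFun]
        split_ifs <;> ring
      map_smul' := fun c b => by
        ext m
        simp only [lp.coeFn_smul, Pi.smul_apply, shiftFun, smul_eq_mul, RingHom.id_apply]
        split_ifs <;> ring } |ρ|⁻¹ fun b =>
    lp.norm_le_of_forall_le (by positivity) fun m => norm_shiftFun_le ρ i b m

theorem shift_apply (ρ : ℝ) (i : Fin r) (b : CoeffSpace r) (m : Fin r →₀ ℕ) :
    shift ρ i b m = shiftFun ρ i b m := rfl

/-- The power series with coefficients `b m / ρ ^ |m|`. -/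
def toSeries (ρ : ℝ) (b : (Fin r →₀ ℕ) → ℂ) : MvPowerSeries (Fin r) ℂ :=
  fun m => b m * ((ρ : ℂ)⁻¹) ^ m.degree

theorem coeff_toSeries (ρ : ℝ) (b : (Fin r →₀ ℕ) → ℂ) (m : Fin r →₀ ℕ) :
    MvPowerSeries.coeff m (toSeries ρ b) = b m * ((ρ : ℂ)⁻¹) ^ m.degree := rfl

theorem toSeries_eq (ρ : ℝ) (b : CoeffSpace r) :
    toSeries ρ b = MvPowerSeries.C (b 0) +
      ∑ i, MvPowerSeries.X i * toSeries ρ (shift ρ i b) := by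
  classical
  ext m
  simp only [map_add, map_sum, MvPowerSeries.coeff_C, MvPowerSeries.X,
    MvPowerSeries.coeff_monomial_mul, one_mul, coeff_toSeries]
  by_cases hm : m = 0
  · subst hm
    simp
  · rw [if_neg hm, zero_add]
    have hsupp : m.support.Nonempty := Finsupp.support_nonempty_iff.2 hm
    -- The least variable occurring in `m` is the only one whose shift contributes, so no monomial
    -- is counted twice.
    set i₀ := m.support.min' hsupp with hi₀
    have h0 : m i₀ ≠ 0 := Finsupp.mem_support_iff.1 (Finset.min'_mem _ _)
    have hlt : ∀ j < i₀, m j = 0 := by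
      intro j hj
      by_contra hne
      exact absurd (Finset.min'_le _ _ (Finsupp.mem_support_iff.2 hne)) (not_le.2 hj)
    have hle : Finsupp.single i₀ 1 ≤ m := Finsupp.single_le_iff.2 (Nat.one_le_iff_ne_zero.2 h0)
    have hadd : m - Finsupp.single i₀ 1 + Finsupp.single i₀ 1 = m := tsub_add_cancel_of_le hle
    rw [Finset.sum_eq_single i₀]
    · rw [if_pos hle, shift_apply, shiftFun, if_pos, hadd]
      · have hdeg : m.degree = (m - Finsupp.single i₀ 1).degree + 1 := by
          conv_lhs => rw [← hadd]
          rw [map_add, Finsupp.degree_single]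
        rw [hdeg, pow_succ]
        ring
      · intro j hj
        simp [hlt j hj]
    · intro i _ hi
      split_ifs with hmi
      · rw [shift_apply, shiftFun, if_neg, zero_mul]
        have hmi' : m i ≠ 0 := Nat.one_le_iff_ne_zero.1 (Finsupp.single_le_iff.1 hmi)
        have hlt' : i₀ < i := lt_of_le_of_ne (Finset.min'_le _ _ (Finsupp.mem_support_iff.2 hmi'))
          (Ne.symm hi)
        intro h
        have := h i₀ hlt'
        rw [Finsupp.tsub_apply, Finsupp.single_eq_of_ne (Ne.symm hi), Nat.sub_zero] at this
        exact h0 this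
      · rfl
    · simp

theorem subst_toSeries (ρ : ℝ) (b : CoeffSpace r) {φ : Fin r → PowerSeries ℂ}
    (hφ : ∀ i, PowerSeries.constantCoeff (φ i) = 0) :
    (MvPowerSeries.subst φ (toSeries ρ b) : PowerSeries ℂ) = PowerSeries.C (b 0) +
      ∑ i, φ i * MvPowerSeries.subst φ (toSeries ρ (shift ρ i b)) := by
  have hs : MvPowerSeries.HasSubst φ := MvPowerSeries.hasSubst_of_constantCoeff_zero hφ
  conv_lhs => rw [toSeries_eq]
  rw [← MvPowerSeries.substAlgHom_apply (R := ℂ) hs, map_add, map_sum,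
    MvPowerSeries.substAlgHom_apply, MvPowerSeries.subst_C]
  congr 1
  refine Finset.sum_congr rfl fun i _ => ?_
  rw [map_mul, MvPowerSeries.substAlgHom_X, MvPowerSeries.substAlgHom_apply]

theorem coeff_subst_toSeries_zero (ρ : ℝ) (b : CoeffSpace r) {φ : Fin r → PowerSeries ℂ}
    (hφ : ∀ i, PowerSeries.constantCoeff (φ i) = 0) :
    PowerSeries.coeff 0 (MvPowerSeries.subst φ (toSeries ρ b) : PowerSeries ℂ) = b 0 := by
  rw [subst_toSeries ρ b hφ]
  simp [hφ]

/-- The coefficientwise form of the Volterra equation. The constant term of the substituted shift is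
split off because the Borel transform disregards it; this yields the free term of the equation. -/
theorem coeff_subst_toSeries_succ (ρ : ℝ) (b : CoeffSpace r) {φ : Fin r → PowerSeries ℂ}
    (hφ : ∀ i, PowerSeries.constantCoeff (φ i) = 0) (n : ℕ) :
    PowerSeries.coeff (n + 1) (MvPowerSeries.subst φ (toSeries ρ b) : PowerSeries ℂ) =
      ∑ i, (shift ρ i b 0 * PowerSeries.coeff (n + 1) (φ i) +
        ∑ k ∈ Finset.range n, PowerSeries.coeff (n - 1 - k + 1)
          (MvPowerSeries.subst φ (toSeries ρ (shift ρ i b)) : PowerSeries ℂ) *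
            PowerSeries.coeff (k + 1) (φ i)) := by
  rw [subst_toSeries ρ b hφ, map_add, PowerSeries.coeff_C, if_neg (Nat.succ_ne_zero n), zero_add,
    map_sum]
  refine Finset.sum_congr rfl fun i _ => ?_
  rw [PowerSeries.coeff_mul, Finset.Nat.sum_antidiagonal_eq_sum_range_succ_mk,
    Finset.sum_range_succ, Finset.sum_range_succ']
  simp only [Nat.sub_self, coeff_subst_toSeries_zero ρ _ hφ, PowerSeries.coeff_zero_eq_constantCoeff,
    hφ, zero_mul, add_zero]
  rw [add_comm, mul_comm]
  congr 1
  refine Finset.sum_congr rfl fun k hk => ?_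
  rw [mul_comm, show n + 1 - (k + 1) = n - 1 - k + 1 by have := Finset.mem_range.1 hk; omega]

end Coefficients

/-! ### The operator-valued resolvent and the substitution theorem -/

section Main

variable {r : ℕ}

/-- The operator-valued germ whose resolvent encodes all substitutions. -/
def genFun (ρ : ℝ) (φ : Fin r → ℂ → ℂ) (z : ℂ) : CoeffSpace r →L[ℂ] CoeffSpace r :=
  ∑ i, φ i z • shift ρ i

theorem analyticAt_genFun (ρ : ℝ) {φ : Fin r → ℂ → ℂ} (hφ : ∀ i, AnalyticAt ℂ (φ i) 0) :
    AnalyticAt ℂ (genFun ρ φ) 0 :=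
  Finset.analyticAt_fun_sum _ fun i _ => (hφ i).smul analyticAt_const

theorem exists_resolvent {A : Type*} [NormedRing A] [NormedAlgebra ℂ A] [CompleteSpace A]
    {f : ℂ → A} (hf : AnalyticAt ℂ f 0) :
    ∃ χ : ℂ → A, AnalyticAt ℂ χ 0 ∧ ∀ᶠ z in 𝓝 0, χ z = f z + conv 0 χ f z := by
  obtain ⟨R₁, hR₁, hb⟩ := Metric.eventually_nhds_iff_ball.1 (hf.eventually_analyticAt.and
    (hf.continuousAt.norm.eventually_lt (continuousAt_const (y := ‖f 0‖ + 1)) (lt_add_one _)))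
  set M := ‖f 0‖ + 1 with hM_def
  have hM : 0 < M := by positivity
  set R := min R₁ (1 / (2 * M)) with hR_def
  have hR : 0 < R := lt_min hR₁ (by positivity)
  have hsub : ball (0 : ℂ) R ⊆ ball 0 R₁ := ball_subset_ball (min_le_left _ _)
  have hfd : DifferentiableOn ℂ f (ball 0 R) := fun u hu =>
    (hb u (hsub hu)).1.differentiableAt.differentiableWithinAt
  have hRM : R * M ≤ 1 / 2 := by
    refine (mul_le_mul_of_nonneg_right (min_le_right _ _) hM.le).trans_eq ?_
    field_simp
  obtain ⟨χ, hχ, he⟩ := exists_volterra hfd hfd (fun u hu => (hb u (hsub hu)).2.le) hRM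
  exact ⟨χ, hχ.analyticAt (ball_mem_nhds 0 hR), by
    filter_upwards [ball_mem_nhds 0 hR] with z hz using he z hz⟩

/-- Reduces the operator-valued convolution to scalar ones, since a bounded functional commutes with
the integral. -/
theorem map_conv_eq_sum {A : Type*} [NormedRing A] [NormedAlgebra ℂ A] [CompleteSpace A]
    {ι : Type*} [Fintype ι] {R : ℝ} {X V : ℂ → A} {x v : ι → ℂ → ℂ}
    (hX : ContinuousOn X (ball 0 R)) (hV : ContinuousOn V (ball 0 R))
    (hx : ∀ i, ContinuousOn (x i) (ball 0 R)) (hv : ∀ i, ContinuousOn (v i) (ball 0 R))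
    (T : A →L[ℂ] ℂ) (hT : ∀ a b, T (X a * V b) = ∑ i, x i a * v i b) {z : ℂ}
    (hz : z ∈ ball 0 R) : T (conv 0 X V z) = ∑ i, conv 0 (x i) (v i) z := by
  have hI : IntervalIntegrable (fun s : ℝ => (z - 0) • (X (0 + s * (z - 0)) *
      V (z - (0 + s * (z - 0))))) MeasureTheory.volume 0 1 := by
    refine ContinuousOn.intervalIntegrable ?_
    rw [uIcc_of_le zero_le_one]
    exact continuousOn_conv_integrand hX hV hz
  have hI' : ∀ i, IntervalIntegrable (fun s : ℝ => (z - 0) • (x i (0 + s * (z - 0)) *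
      v i (z - (0 + s * (z - 0))))) MeasureTheory.volume 0 1 := by
    intro i
    refine ContinuousOn.intervalIntegrable ?_
    rw [uIcc_of_le zero_le_one]
    exact continuousOn_conv_integrand (hx i) (hv i) hz
  simp only [conv, lineInt]
  rw [← ContinuousLinearMap.intervalIntegral_comp_comm T hI,
    ← intervalIntegral.integral_finsetSum fun i _ => hI' i]
  simp only [map_smul, hT, Finset.smul_sum]

theorem evalZero_conv {ρ : ℝ} {φ : Fin r → ℂ → ℂ} (hφ : ∀ i, AnalyticAt ℂ (φ i) 0)
    {χ : ℂ → CoeffSpace r →L[ℂ] CoeffSpace r} (hχ : AnalyticAt ℂ χ 0) (b : CoeffSpace r) :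
    ∀ᶠ z in 𝓝 0, evalZero r (conv 0 χ (genFun ρ φ) z b) =
      ∑ i, conv 0 (fun u => evalZero r (χ u (shift ρ i b))) (φ i) z := by
  have hφe : ∀ᶠ z in 𝓝 (0 : ℂ), ∀ i, AnalyticAt ℂ (φ i) z :=
    eventually_all.2 fun i => (hφ i).eventually_analyticAt
  obtain ⟨R, hR, hb⟩ := Metric.eventually_nhds_iff_ball.1 (hχ.eventually_analyticAt.and hφe)
  filter_upwards [ball_mem_nhds 0 hR] with z hz
  have cχ : ContinuousOn χ (ball 0 R) := fun u hu => (hb u hu).1.continuousAt.continuousWithinAt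
  have cφ : ∀ i, ContinuousOn (φ i) (ball 0 R) := fun i u hu =>
    ((hb u hu).2 i).continuousAt.continuousWithinAt
  have cg : ContinuousOn (genFun ρ φ) (ball 0 R) :=
    continuousOn_finsetSum _ fun i _ => (cφ i).smul continuousOn_const
  have ce : ∀ c : CoeffSpace r, ContinuousOn (fun u => evalZero r (χ u c)) (ball 0 R) := fun c =>
    (evalZero r).continuous.comp_continuousOn (cχ.clm_apply continuousOn_const)
  refine map_conv_eq_sum cχ cg (fun i => ce (shift ρ i b)) cφ
    ((evalZero r).comp (ContinuousLinearMap.apply ℂ (CoeffSpace r) b)) (fun u v => ?_) hz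
  change evalZero r (χ u (genFun ρ φ v b)) = _
  simp only [genFun, sum_apply, smul_apply, map_sum, map_smul, smul_eq_mul]
  exact Finset.sum_congr rfl fun i _ => mul_comm _ _

/-- Both sides satisfy the same recursion in `n`. It involves `shift ρ i b` in place of `b`, so the
strong induction must run over all `b` at once. -/
theorem iteratedDeriv_resolvent {ρ : ℝ} {φ : Fin r → PowerSeries ℂ}
    (hφ0 : ∀ i, PowerSeries.constantCoeff (φ i) = 0) {f : Fin r → ℂ → ℂ}
    (hf : ∀ i, AnalyticAt ℂ (f i) 0)
    (hfd : ∀ i n, iteratedDeriv n (f i) 0 = PowerSeries.coeff (n + 1) (φ i))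
    {χ : ℂ → CoeffSpace r →L[ℂ] CoeffSpace r} (hχ0 : AnalyticAt ℂ χ 0)
    (hχ : ∀ᶠ z in 𝓝 0, χ z = genFun ρ f z + conv 0 χ (genFun ρ f) z) (n : ℕ) (b : CoeffSpace r) :
    iteratedDeriv n (fun z => evalZero r (χ z b)) 0 =
      PowerSeries.coeff (n + 1) (MvPowerSeries.subst φ (toSeries ρ b) : PowerSeries ℂ) := by
  induction n using Nat.strong_induction_on generalizing b with | _ n ih =>
  have hx : ∀ c : CoeffSpace r, AnalyticAt ℂ (fun z => evalZero r (χ z c)) 0 := fun c =>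
    ((evalZero r).comp (ContinuousLinearMap.apply ℂ (CoeffSpace r) c)).analyticAt _ |>.comp hχ0
  have hconv : ∀ i, AnalyticAt ℂ
      (conv 0 (fun u => evalZero r (χ u (shift ρ i b))) (f i)) 0 := by
    intro i
    obtain ⟨R, hR, hb⟩ := Metric.eventually_nhds_iff_ball.1
      ((hx (shift ρ i b)).eventually_analyticAt.and (hf i).eventually_analyticAt)
    exact (differentiableOn_conv
      (fun u hu => (hb u hu).1.differentiableAt.differentiableWithinAt)
      (fun u hu => (hb u hu).2.differentiableAt.differentiableWithinAt)).analyticAt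
        (ball_mem_nhds 0 hR)
  have heq : (fun z => evalZero r (χ z b)) =ᶠ[𝓝 0] fun z =>
      ∑ i, (shift ρ i b 0 * f i z +
        conv 0 (fun u => evalZero r (χ u (shift ρ i b))) (f i) z) := by
    filter_upwards [hχ, evalZero_conv (ρ := ρ) hf hχ0 b] with z h1 h2
    rw [h1, add_apply, map_add, h2, ← Finset.sum_add_distrib.symm]
    congr 1
    simp only [genFun, sum_apply, smul_apply, map_sum,
      map_smul, smul_eq_mul, evalZero_apply]
    exact Finset.sum_congr rfl fun i _ => mul_comm _ _
  have h1 : ∀ i, AnalyticAt ℂ (fun z => shift ρ i b 0 * f i z) 0 := fun i =>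
    analyticAt_const.mul (hf i)
  have h2 : ∀ i, AnalyticAt ℂ (fun z => shift ρ i b 0 * f i z +
      conv 0 (fun u => evalZero r (χ u (shift ρ i b))) (f i) z) 0 := fun i => (h1 i).add (hconv i)
  rw [heq.iteratedDeriv_eq, iteratedDeriv_fun_sum fun i _ => (h2 i).contDiffAt,
    coeff_subst_toSeries_succ ρ b hφ0]
  refine Finset.sum_congr rfl fun i _ => ?_
  rw [iteratedDeriv_fun_add (h1 i).contDiffAt (hconv i).contDiffAt,
    iteratedDeriv_const_mul_field, hfd, iteratedDeriv_conv (hx _) (hf i)]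
  congr 1
  refine Finset.sum_congr rfl fun k hk => ?_
  rw [hfd, ih _ (by have := Finset.mem_range.1 hk; omega)]

/-- Substituting resurgent series without constant term into a convergent series. -/
theorem subst_mem_resurgent (Ω : Fin r → DFS) {F : MvPowerSeries (Fin r) ℂ} (hF : IsConvergent F)
    {φ : Fin r → PowerSeries ℂ} (hφ₀ : ∀ i, PowerSeries.constantCoeff (φ i) = 0)
    (hφ : ∀ i, φ i ∈ resurgent (Ω i)) :
    (MvPowerSeries.subst φ F : PowerSeries ℂ) ∈ resurgent (DFS.iterSum (∏ i, Ω i)) := by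
  obtain ⟨ρ, hρ, hsum⟩ := hF
  have hφ' : ∀ i, (borel (φ i)).2 ∈ continuable (Ω i) := fun i => (hφ i).2
  choose f hfp hfc using hφ'
  have hf : ∀ i, AnalyticAt ℂ (f i) 0 := fun i => (hfp i).analyticAt
  have hfd : ∀ i n, iteratedDeriv n (f i) 0 = PowerSeries.coeff (n + 1) (φ i) := by
    intro i n
    rw [iteratedDeriv_of_hasFPowerSeriesAt (hfp i), borel, PowerSeries.coeff_mk, mul_div_cancel₀]
    exact_mod_cast n.factorial_ne_zero
  -- The components of the operator-valued germ need a common singular set; the sum of the `Ω i`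
  -- contains each of them.
  have hfS : ∀ i Λ, ChainCont (∏ i, Ω i).realGraph (f i) Λ := fun i Λ =>
    (chainCont_of_continuable (hf i) (hfc i) Λ).mono (DFS.realGraph_subset_prod Ω i) le_rfl
  have hg0 := analyticAt_genFun ρ hf
  have hgS : ∀ Λ, ChainCont (∏ i, Ω i).realGraph (genFun ρ f) Λ := fun Λ =>
    ChainCont.sum _ fun i =>
      (hfS i Λ).map ((ContinuousLinearMap.id ℂ ℂ).smulRight (shift ρ i))
  obtain ⟨χ, hχ0, hχ⟩ := exists_resolvent hg0
  obtain ⟨δ, hδ, hle⟩ := (∏ i, Ω i).exists_le_realGraph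
  have hχS := ChainCont.resolvent hδ hle (DFS.realGraph_subset_iterSum _)
    (fun s hs t ht => DFS.add_mem_realGraph_iterSum _ hs ht) hg0 hχ0 hχ hgS
  -- Convergence of `F` enters only here: rescaling by a polyradius of convergence makes the
  -- coefficients bounded.
  let b : CoeffSpace r := ⟨fun m => MvPowerSeries.coeff m F * (ρ : ℂ) ^ m.degree,
    memℓp_infty ⟨∑' k : Fin r →₀ ℕ, ‖MvPowerSeries.coeff k F‖ * ρ ^ k.degree, by
      rintro _ ⟨m, rfl⟩
      beta_reduce
      rw [norm_mul, norm_pow, Complex.norm_real, Real.norm_of_nonneg hρ.le]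
      exact hsum.le_tsum m fun k _ => by positivity⟩⟩
  have hbF : toSeries ρ b = F := by
    ext m
    have hρ' : (ρ : ℂ) ≠ 0 := by exact_mod_cast hρ.ne'
    rw [coeff_toSeries]
    change MvPowerSeries.coeff m F * (ρ : ℂ) ^ m.degree * ((ρ : ℂ)⁻¹) ^ m.degree = _
    rw [mul_assoc, ← mul_pow, mul_inv_cancel₀ hρ', one_pow, mul_one]
  let T : (CoeffSpace r →L[ℂ] CoeffSpace r) →L[ℂ] ℂ :=
    (evalZero r).comp (ContinuousLinearMap.apply ℂ (CoeffSpace r) b)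
  have hx0 : AnalyticAt ℂ (fun z => evalZero r (χ z b)) 0 := (T.analyticAt _).comp hχ0
  refine ⟨mem_univ _, fun z => evalZero r (χ z b), ?_, fun γ hγ =>
    continuableAlong_of_chainCont (fun Λ => (hχS Λ).map T) hγ⟩
  have := hx0.hasFPowerSeriesAt
  simp only [iteratedDeriv_resolvent hφ₀ hf hfd hχ0 hχ, hbF] at this
  simpa only [borel, PowerSeries.coeff_mk] using this

end Main

end Resurgence

end

theorem theorem2 (r : ℕ) (hr : 1 ≤ r) (Ω : Fin r → Resurgence.DFS)
    (F : MvPowerSeries (Fin r) ℂ) (hF : Resurgence.IsConvergent F)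
    (φ : Fin r → PowerSeries ℂ) (hφ₀ : ∀ i, PowerSeries.constantCoeff (φ i) = 0)
    (hφ : ∀ i, φ i ∈ Resurgence.resurgent (Ω i)) :
    (MvPowerSeries.subst φ F : PowerSeries ℂ) ∈
      Resurgence.resurgent (Resurgence.DFS.iterSum (∏ i, Ω i)) := by
  exact Resurgence.subst_mem_resurgent Ω hF hφ₀ hφ
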